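/- Let $m,n,t$ be positive integers with $t\le mn$, and write $[N]=\{1,2,\ldots,N\}$. A set partition of $[mn]$ is $m$-divisible if every block has size divisible by $m$, and it is a $t$-partition if no block contains more than one element of $[t]$. A $t$-partition is non-crossing if there are no indices $i<j<k<l$ such that either $j\le t$ and $i,l$ belong to one block and $j,k$ belong to a different block, or $j>t$ and $i,k$ belong to one block and $j,l$ belong to a different block. Let $\mathbf{NC}_{n,t}^{(m)}$ be the set of all $m$-divisible non-crossing $t$-partitions of $[mn]$; the rank of such a partition is $n$ minus its number of blocks. Binomial coefficients $\binom{N}{k}$ with $k<0$ or $k>N\geq 0$ are $0$. Then the following hold. (1) Let $b_1,\ldots,b_n$ be non-negative integers and $b=b_1+b_2+\cdots+b_n$. If $b_1+2b_2+\cdots+nb_n=n$, then the number of elements of $\mathbf{NC}_{n,t}^{(m)}$ with exactly $b_i$ blocks of size $mi$, for all $i\in[n]$, equals $$\frac{(mn-t+1)\,b-mn\,(b-t)}{(mn-t+1)\,b}\binom{mn-t+1}{b-t}\binom{b}{b_1,b_2,\ldots,b_n}.$$ If $b_1+2b_2+\cdots+nb_n\neq n$, there are no such elements. (2) For every non-negative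 integer $s$, the number of elements of $\mathbf{NC}_{n,t}^{(m)}$ of rank $s$ equals $$\frac{mnt-(n-s)(t-1)}{n(mn-t+1)}\binom{mn-t+1}{n-s-t}\binom{n}{s}.$$ (3) The total number of elements of $\mathbf{NC}_{n,t}^{(m)}$ is $$\frac{mt+1}{mn+1}\binom{(m+1)n-t}{n-t}.$$ -/

import Mathlib

namespace TNoncrossing

/-- `π` is `m`-divisible: every block has size divisible by `m`. -/
def IsDivisible (m : ℕ) {N : ℕ} (π : Finpartition (Finset.Icc 1 N)) : Prop :=
  ∀ B ∈ π.parts, m ∣ B.card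

/-- `π` is a `t`-partition: no block meets `{1, …, t}` in more than one element. -/
def IsTPartition (t : ℕ) {N : ℕ} (π : Finpartition (Finset.Icc 1 N)) : Prop :=
  ∀ B ∈ π.parts, (B ∩ Finset.Icc 1 t).card ≤ 1

/-- The non-crossing condition for `t`-partitions: there are no `i < j < k < l` such that either
`j ≤ t` and `i, l` lie in one block and `j, k` in a different one, or `t < j` and `i, k` lie in one
block and `j, l` in a different one. -/
def IsNoncrossing (t : ℕ) {N : ℕ} (π : Finpartition (Finset.Icc 1 N)) : Prop :=
  ¬ ∃ i j k l : ℕ, i < j ∧ j < k ∧ k < l ∧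
    ∃ A ∈ π.parts, ∃ B ∈ π.parts, A ≠ B ∧
      ((j ≤ t ∧ i ∈ A ∧ l ∈ A ∧ j ∈ B ∧ k ∈ B) ∨
       (t < j ∧ i ∈ A ∧ k ∈ A ∧ j ∈ B ∧ l ∈ B))

/-- The set of all `m`-divisible non-crossing `t`-partitions of `{1, …, m * n}`. -/
def NC (m n t : ℕ) : Set (Finpartition (Finset.Icc 1 (m * n))) :=
  {π | IsDivisible m π ∧ IsTPartition t π ∧ IsNoncrossing t π}

/-- The number of blocks of `π` of size `k`. -/
def blocksOfSize {N : ℕ} (π : Finpartition (Finset.Icc 1 N)) (k : ℕ) : ℕ :=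
  (π.parts.filter (fun B => B.card = k)).card

/-- The rank of an `m`-divisible partition of `{1, …, m * n}`: `n` minus the number of blocks. -/
def rk {m n : ℕ} (π : Finpartition (Finset.Icc 1 (m * n))) : ℤ :=
  (n : ℤ) - (π.parts.card : ℤ)

/-- The binomial coefficient with natural upper and integer lower index; it is `0` when the lower
index is negative. -/
def binom (N : ℕ) (k : ℤ) : ℕ :=
  if 0 ≤ k then N.choose k.toNat else 0

end TNoncrossing

/-! List $[mn]$ in the order $t,\ldots,1,t+1,\ldots,mn$. For a $t$-partition the two forbidden
patterns together become ordinary crossing in this order (`isNoncrossing_iff`), and being a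
$t$-partition means that each of the first $t$ elements is the minimum of its block
(`isTPartition_iff`). Writing the size of each block at its minimum and 0 elsewhere identifies
non-crossing partitions with ballot words (`word_injective`, `exists_word_eq`). The block type
becomes the multiset of non-zero letters, and the $t$-condition says that the first $t$ letters are
non-zero.

Ballot words with given non-zero letters are counted from an arbitrary starting height, first for
$t=0$ (`ncard_ballotWords_base`). For a fixed length that count is affine in the height, so $t$
forced letters enter only through their mean sum (`ncard_ballotWords`). This gives (1). The result
depends on the type only through the number $b$ of blocks and a multinomial coefficient; these
coefficients add up to the number of compositions of $n$ into $b$ parts, which gives (2). Summing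
over $b$ takes two Vandermonde convolutions and gives (3). -/

namespace TNoncrossing

/-! ### Counting ballot words by their non-zero letters -/

/-- Starting at height `h`, each letter `a` moves the height by `a - 1`; the path stays
non-negative and ends at height `0`. -/
def Ballot : ℕ → List ℕ → Prop
  | h, [] => h = 0
  | h, a :: w => 1 ≤ h + a ∧ Ballot (h + a - 1) w

theorem ballot_iff (h : ℕ) (w : List ℕ) :
    Ballot h w ↔ (∀ k ≤ w.length, k ≤ h + (w.take k).sum) ∧ h + w.sum = w.length := by
  induction w generalizing h with
  | nil => simp [Ballot]
  | cons a w ih =>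
    rw [Ballot, ih]
    constructor
    · rintro ⟨h1, h2, h3⟩
      refine ⟨fun k hk => ?_, by simp; omega⟩
      cases k with
      | zero => omega
      | succ k =>
        have := h2 k (by simpa using hk)
        simp; omega
    · rintro ⟨h1, h2⟩
      have h0 := h1 1 (by simp)
      simp at h0 h2
      refine ⟨h0, fun k hk => ?_, by omega⟩
      have := h1 (k + 1) (by simpa using hk)
      simp at this
      omega

/-- Ballot words from height `h` whose non-zero letters form the multiset `C` and whose first `t`
letters are non-zero. -/
def ballotWords (t h : ℕ) (C : Multiset ℕ) : Set (List ℕ) :=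
  {w | (↑(w.filter (· ≠ 0)) : Multiset ℕ) = C ∧ Ballot h w ∧ ∀ i < t, w.getD i 0 ≠ 0}

theorem sum_filter_ne_zero (w : List ℕ) : (w.filter (· ≠ 0)).sum = w.sum := by
  induction w with
  | nil => rfl
  | cons a w ih =>
    by_cases ha : a = 0
    · simp [ha] at ih ⊢; exact ih
    · simp [ha] at ih ⊢; exact ih

theorem length_of_mem_ballotWords {t h : ℕ} {C : Multiset ℕ} {w : List ℕ}
    (hw : w ∈ ballotWords t h C) : w.length = h + C.sum := by
  obtain ⟨h1, h2, -⟩ := hw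
  rw [← ((ballot_iff h w).1 h2).2, ← h1, Multiset.sum_coe, sum_filter_ne_zero]

/-- The length is forced, hence so is the number of zeros: every such word rearranges one fixed
multiset. -/
theorem finite_ballotWords (t h : ℕ) (C : Multiset ℕ) : (ballotWords t h C).Finite := by
  refine ((List.finite_toSet
    (C + Multiset.replicate (h + C.sum - C.card) 0).toList.permutations)).subset fun w hw => ?_
  have hl := length_of_mem_ballotWords hw
  obtain ⟨h1, -, -⟩ := hw
  simp only [Set.mem_ofPred_eq, List.mem_permutations]
  have h2 := Multiset.filter_add_not (· ≠ 0) (w : Multiset ℕ)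
  have h3 : Multiset.filter (fun a => ¬ a ≠ 0) (w : Multiset ℕ) =
      Multiset.replicate (h + C.sum - C.card) 0 := by
    rw [Multiset.eq_replicate]
    refine ⟨?_, fun b hb => by simpa using (Multiset.mem_filter.1 hb).2⟩
    have := congrArg Multiset.card h2
    rw [Multiset.card_add, Multiset.filter_coe, h1, Multiset.coe_card, hl] at this
    omega
  rw [h3, Multiset.filter_coe, h1] at h2
  rw [← Multiset.coe_eq_coe, Multiset.coe_toList, h2]

theorem cons_mem_ballotWords_succ {t h : ℕ} {C : Multiset ℕ} {a : ℕ} {w : List ℕ} :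
    a :: w ∈ ballotWords (t + 1) h C ↔
      a ≠ 0 ∧ a ∈ C ∧ w ∈ ballotWords t (h + a - 1) (C.erase a) := by
  simp only [ballotWords, Set.mem_ofPred_eq, Ballot]
  constructor
  · rintro ⟨rfl, ⟨h1, h2⟩, h3⟩
    have ha : a ≠ 0 := h3 0 (by omega)
    refine ⟨ha, by simp [ha], by simp [ha], h2, fun i hi => ?_⟩
    simpa using h3 (i + 1) (by omega)
  · rintro ⟨ha, haC, h1, h2, h3⟩
    refine ⟨?_, ⟨by omega, h2⟩, fun i hi => ?_⟩
    · rw [List.filter_cons_of_pos (by simpa using ha), ← Multiset.cons_coe, h1,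
        Multiset.cons_erase haC]
    · cases i with
      | zero => simpa using ha
      | succ i => simpa using h3 i (by omega)

theorem cons_mem_ballotWords_zero {h : ℕ} {C : Multiset ℕ} (hC : 0 ∉ C) {a : ℕ} {w : List ℕ} :
    a :: w ∈ ballotWords 0 h C ↔
      (a = 0 ∧ 1 ≤ h ∧ w ∈ ballotWords 0 (h - 1) C) ∨
      (a ∈ C ∧ w ∈ ballotWords 0 (h + a - 1) (C.erase a)) := by
  by_cases ha : a = 0
  · subst ha
    simp [ballotWords, Ballot, hC]; tauto
  · have h1 : a :: w ∈ ballotWords 0 h C ↔ a :: w ∈ ballotWords 1 h C := by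
      simp [ballotWords, ha]
    rw [h1, cons_mem_ballotWords_succ]
    simp [ha]

theorem ncard_ballotWords_succ (t h : ℕ) (C : Multiset ℕ) (hC : 0 ∉ C) :
    (ballotWords (t + 1) h C).ncard =
      ∑ a ∈ C.toFinset, (ballotWords t (h + a - 1) (C.erase a)).ncard := by
  have : ballotWords (t + 1) h C =
      ⋃ a ∈ (C.toFinset : Set ℕ), List.cons a '' ballotWords t (h + a - 1) (C.erase a) := by
    ext w
    cases w with
    | nil =>
      simp [ballotWords]
      intro _ _
      exact ⟨0, by omega⟩
    | cons a w =>
      rw [cons_mem_ballotWords_succ]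
      simp only [Finset.mem_coe, Multiset.mem_toFinset, Set.mem_iUnion, Set.mem_image,
        List.cons.injEq, exists_prop]
      constructor
      · rintro ⟨-, h1, h2⟩; exact ⟨a, h1, w, h2, rfl, rfl⟩
      · rintro ⟨a, h1, w, h2, rfl, rfl⟩; exact ⟨fun h => hC (h ▸ h1), h1, h2⟩
  rw [this, Set.Finite.ncard_biUnion (Finset.finite_toSet _)
    (fun a _ => (finite_ballotWords _ _ _).image _), finsum_mem_coe_finset]
  · exact Finset.sum_congr rfl fun a _ => Set.ncard_image_of_injective _ List.cons_injective
  · intro a _ b _ hab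
    rw [Function.onFun, Set.disjoint_left]
    rintro _ ⟨u, -, rfl⟩ ⟨v, -, h⟩
    exact hab (List.cons.inj h).1.symm

/-- A non-empty word starts with 0, a down step that needs positive height, or with a non-zero
letter; the latter case is $t=1$. -/
theorem ncard_ballotWords_zero (h : ℕ) (C : Multiset ℕ) (hC : 0 ∉ C) (hpos : 0 < h + C.sum) :
    (ballotWords 0 h C).ncard =
      (if 1 ≤ h then (ballotWords 0 (h - 1) C).ncard else 0) + (ballotWords 1 h C).ncard := by
  have : ballotWords 0 h C =
      (if 1 ≤ h then List.cons 0 '' ballotWords 0 (h - 1) C else ∅) ∪ ballotWords 1 h C := by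
    ext w
    cases w with
    | nil =>
      constructor
      · intro hw
        have := length_of_mem_ballotWords hw
        simp at this; simp at hpos; omega
      · rintro (hw | hw)
        · split_ifs at hw
          · simp at hw
          · simp at hw
        · exact absurd rfl (hw.2.2 0 (by omega))
    | cons a w =>
      rw [Set.mem_union, cons_mem_ballotWords_zero hC, cons_mem_ballotWords_succ]
      refine or_congr ?_ ?_
      · split_ifs with h1
        · simp [h1]; tauto
        · simp [h1]
      · constructor
        · rintro ⟨h1, h2⟩; exact ⟨fun h => hC (h ▸ h1), h1, h2⟩
        · rintro ⟨-, h1, h2⟩; exact ⟨h1, h2⟩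
  rw [this, Set.ncard_union_eq _ _ (finite_ballotWords _ _ _)]
  · split_ifs
    · rw [Set.ncard_image_of_injective _ List.cons_injective]
    · simp
  · rw [Set.disjoint_left]
    intro w h1 h2
    split_ifs at h1
    · obtain ⟨u, -, rfl⟩ := h1
      exact h2.2.2 0 (by omega) rfl
    · exact h1
  · split_ifs
    · exact (finite_ballotWords _ _ _).image _
    · simp

theorem ballotWords_zero_zero : ballotWords 0 0 0 = {[]} := by
  ext w
  constructor
  · intro hw
    have := length_of_mem_ballotWords hw
    simpa using this
  · rintro rfl
    simp [ballotWords, Ballot]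

/-- Among the arrangements of `C`, the proportion that begins with `a` is its multiplicity over the
cardinality. -/
theorem countPerms_erase (C : Multiset ℕ) (a : ℕ) (ha : a ∈ C) :
    (C.erase a).countPerms * C.card = C.count a * C.countPerms := by
  rw [Multiset.countPerms_filter_ne a C, Multiset.countPerms_filter_ne a (C.erase a)]
  have h1 : (C.erase a).filter (a ≠ ·) = C.filter (a ≠ ·) := by
    ext b
    by_cases hb : a = b
    · simp [hb]
    · simp [hb, Multiset.count_erase_of_ne (Ne.symm hb)]
  have h2 : 0 < C.count a := Multiset.count_pos.2 ha
  have h3 : 0 < C.card := Multiset.card_pos_iff_exists_mem.2 ⟨a, ha⟩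
  rw [h1, Multiset.card_erase_of_mem ha, Multiset.count_erase_self]
  obtain ⟨c, hc⟩ : ∃ c, C.count a = c + 1 := ⟨_, (Nat.succ_pred_eq_of_pos h2).symm⟩
  obtain ⟨d, hd⟩ : ∃ d, C.card = d + 1 := ⟨_, (Nat.succ_pred_eq_of_pos h3).symm⟩
  rw [hc, hd]
  have := Nat.add_one_mul_choose_eq d c
  simp only [Nat.pred_succ, Nat.add_sub_cancel]
  linear_combination (Multiset.filter (a ≠ ·) C).countPerms * this

/-- Averaging an affine function over the choice of a first letter. -/
theorem sum_countPerms_erase (C : Multiset ℕ) (u v : ℚ) :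
    (∑ a ∈ C.toFinset, ((C.erase a).countPerms : ℚ) * (u + v * a)) * C.card =
      C.countPerms * (u * C.card + v * C.sum) := by
  have h1 : (C.card : ℚ) = ∑ a ∈ C.toFinset, (C.count a : ℚ) := by
    rw [← Multiset.toFinset_sum_count_eq]; push_cast; rfl
  have h2 : (C.sum : ℚ) = ∑ a ∈ C.toFinset, (C.count a : ℚ) * a := by
    rw [Finset.sum_multiset_count]; push_cast; simp
  rw [Finset.sum_mul]
  have h3 : ∀ a ∈ C.toFinset, ((C.erase a).countPerms : ℚ) * (u + v * a) * C.card =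
      C.countPerms * (u * C.count a + v * (C.count a * a)) := by
    intro a ha
    have : ((C.erase a).countPerms : ℚ) * C.card = C.count a * C.countPerms := by
      exact_mod_cast countPerms_erase C a (Multiset.mem_toFinset.1 ha)
    linear_combination (u + v * a) * this
  rw [Finset.sum_congr rfl h3, ← Finset.mul_sum, Finset.sum_add_distrib, ← Finset.mul_sum,
    ← Finset.mul_sum, ← h1, ← h2]

theorem card_le_sum {C : Multiset ℕ} (hC : 0 ∉ C) : C.card ≤ C.sum := by
  induction C using Multiset.induction with
  | empty => simp
  | cons a C ih =>
    simp only [Multiset.mem_cons, not_or] at hC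
    have := ih hC.2
    simp
    omega

/-- This is the cycle lemma count for words of length $L=h+\sum C$, with a final down step appended.
The proof is by induction on $L$ through the first letter: a non-zero letter $a$ contributes a
factor $h+a$, affine in $a$, so averaging leaves only the size and the sum of `C`. Pascal's rule and
absorption then combine the two cases. -/
theorem ncard_ballotWords_base (h : ℕ) (C : Multiset ℕ) (hC : 0 ∉ C) :
    ((ballotWords 0 h C).ncard : ℚ) * (h + C.sum + 1) =
      (h + 1) * (h + C.sum + 1).choose C.card * C.countPerms := by
  induction hL : h + C.sum using Nat.strong_induction_on generalizing h C with
  | _ L ih =>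
  rcases Nat.eq_zero_or_pos L with h0 | hpos
  · have hh : h = 0 := by omega
    have hC0 : C = 0 := by
      have := card_le_sum hC
      rw [← Multiset.card_eq_zero]; omega
    subst hh hC0
    simp [ballotWords_zero_zero, ← hL]
  · rw [ncard_ballotWords_zero h C hC (by omega), ncard_ballotWords_succ 0 h C hC]
    have hLq : (h : ℚ) + C.sum = L := by exact_mod_cast hL
    have hL0 : (L : ℚ) ≠ 0 := by positivity
    have e1 : (((if 1 ≤ h then (ballotWords 0 (h - 1) C).ncard else 0 : ℕ) : ℚ)) * L =
        h * L.choose C.card * C.countPerms := by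
      split_ifs with h1
      · obtain ⟨k, rfl⟩ : ∃ k, h = k + 1 := ⟨h - 1, by omega⟩
        have := ih (k + C.sum) (by omega) k C hC rfl
        have hk : k + C.sum + 1 = L := by omega
        rw [hk] at this
        have hkq : (k : ℚ) + C.sum + 1 = L := by exact_mod_cast hk
        rw [hkq] at this
        simpa using this
      · have : h = 0 := by omega
        simp [this]
    have e2 : (∑ a ∈ C.toFinset, ((ballotWords 0 (h + a - 1) (C.erase a)).ncard : ℚ)) * L * C.card =
        L.choose (C.card - 1) * (C.countPerms * (h * C.card + 1 * C.sum)) := by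
      rw [← sum_countPerms_erase, Finset.sum_mul, ← mul_assoc, Finset.mul_sum]
      congr 1
      refine Finset.sum_congr rfl fun a ha => ?_
      have ha := Multiset.mem_toFinset.1 ha
      have hapos : a ≠ 0 := fun h => hC (h ▸ ha)
      have hs : a + (C.erase a).sum = C.sum := Multiset.sum_erase ha
      obtain ⟨k, hk⟩ : ∃ k, h + a = k + 1 := ⟨h + a - 1, by omega⟩
      have hk' : h + a - 1 = k := by omega
      have := ih (k + (C.erase a).sum) (by omega) k (C.erase a)
        (fun h => hC (Multiset.mem_of_mem_erase h)) rfl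
      have hkL : k + (C.erase a).sum + 1 = L := by omega
      have hkLq : (k : ℚ) + (C.erase a).sum + 1 = L := by exact_mod_cast hkL
      have hkq : (h : ℚ) + a = k + 1 := by exact_mod_cast hk
      rw [hkL, hkLq, Multiset.card_erase_of_mem ha] at this
      rw [hk', this, one_mul, hkq]
      simp only [Nat.pred_eq_sub_one]
      ring
    push_cast [-Nat.cast_multiset_sum] at e1 e2 ⊢
    rw [hLq]
    -- `e2` carries a factor `C.card` and is vacuous for empty `C`; there no non-zero first letter
    -- is available and `e1` suffices.
    rcases Nat.eq_zero_or_pos C.card with hb | hb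
    · rw [Multiset.card_eq_zero] at hb
      subst hb
      simp at hLq
      subst hLq
      have h1 : 1 ≤ h := hpos
      simp only [h1, if_true, Multiset.card_zero, Nat.choose_zero_right, Multiset.countPerms_zero,
        Multiset.toFinset_zero, Finset.sum_empty, Nat.cast_one, mul_one] at e1 ⊢
      have : ((ballotWords 0 (h - 1) 0).ncard : ℚ) = 1 := by
        refine mul_right_cancel₀ hL0 ?_
        rw [e1, one_mul]
      rw [this]; ring
    · obtain ⟨c, hc⟩ : ∃ c, C.card = c + 1 := ⟨C.card - 1, by omega⟩
      rw [hc] at e1 e2 ⊢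
      have hcq : (c : ℚ) + 1 ≠ 0 := by positivity
      have p1 : ((L : ℚ) + 1) * L.choose c = (L + 1).choose (c + 1) * (c + 1) := by
        exact_mod_cast Nat.add_one_mul_choose_eq L c
      have p2 : ((L + 1).choose (c + 1) : ℚ) = L.choose c + L.choose (c + 1) := by
        exact_mod_cast Nat.choose_succ_succ L c
      simp only [Nat.add_sub_cancel] at e2
      push_cast [-Nat.cast_multiset_sum] at e2
      refine mul_right_cancel₀ (mul_ne_zero hL0 hcq) ?_
      have hs : (C.sum : ℚ) = L - h := by linarith
      rw [hs] at e2
      linear_combination (L + 1 : ℚ) * (c + 1) * e1 + (L + 1 : ℚ) * e2 +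
        (C.countPerms : ℚ) * (L - h) * p1 -
        (C.countPerms : ℚ) * (L + 1) * (c + 1) * h * p2

/-- The last factor is one plus the mean height after $t$ forced letters, whose mean sum over
arrangements of `C` is $t\sum C/|C|$; the other factors come from the case $t=0$. Induction on $t$
removes one letter at a time. -/
theorem ncard_ballotWords (t h : ℕ) (C : Multiset ℕ) (hC : 0 ∉ C) (ht : t ≤ C.card) :
    ((ballotWords t h C).ncard : ℚ) * (h + C.sum - t + 1) =
      (h + C.sum - t + 1).choose (C.card - t) * C.countPerms *
        (h + 1 - t + t * C.sum / C.card) := by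
  induction t generalizing h C with
  | zero =>
    have := ncard_ballotWords_base h C hC
    simp [-Nat.cast_multiset_sum]
    linear_combination this
  | succ t ih =>
    have hb : (C.card : ℚ) ≠ 0 := by
      have : 0 < C.card := by omega
      positivity
    have hle := card_le_sum hC
    rw [ncard_ballotWords_succ t h C hC]
    push_cast [-Nat.cast_multiset_sum]
    refine mul_right_cancel₀ hb ?_
    -- The mean of the letters left after removing $a$ is $(\sum C-a)/(|C|-1)$, so the summand takes
    -- the form $u+va$ required for averaging.
    have key : ∀ a ∈ C.toFinset, ((ballotWords t (h + a - 1) (C.erase a)).ncard : ℚ) *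
        (h + C.sum - (t + 1) + 1) =
        (h + C.sum - (t + 1) + 1).choose (C.card - (t + 1)) * ((C.erase a).countPerms *
          ((h - t + t * C.sum / (C.card - 1)) + (1 - t / (C.card - 1)) * a)) := by
      intro a ha
      have ha := Multiset.mem_toFinset.1 ha
      have hapos : a ≠ 0 := fun h => hC (h ▸ ha)
      have hs : a + (C.erase a).sum = C.sum := Multiset.sum_erase ha
      have hcard := Multiset.card_erase_add_one ha
      obtain ⟨k, hk⟩ : ∃ k, h + a = k + 1 := ⟨h + a - 1, by omega⟩
      have hk' : h + a - 1 = k := by omega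
      have := ih k (C.erase a) (fun h => hC (Multiset.mem_of_mem_erase h)) (by omega)
      have hN : k + (C.erase a).sum - t + 1 = h + C.sum - (t + 1) + 1 := by omega
      have hkq : (k : ℚ) = h + a - 1 := by
        rw [eq_sub_iff_add_eq]; exact_mod_cast hk.symm
      have hsq : ((C.erase a).sum : ℚ) = C.sum - a := by
        rw [eq_sub_iff_add_eq, add_comm]; exact_mod_cast hs
      have hcq : ((C.erase a).card : ℚ) = C.card - 1 := by
        rw [eq_sub_iff_add_eq]; exact_mod_cast hcard
      have hN' : (C.erase a).card - t = C.card - (t + 1) := by omega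
      rw [hN, hN', hkq, hsq, hcq] at this
      rw [hk']
      linear_combination this
    rw [Finset.sum_mul, Finset.sum_congr rfl key, ← Finset.mul_sum, mul_assoc _ _ (C.card : ℚ),
      sum_countPerms_erase]
    -- Division by $|C|-1$ is harmless: for $t=0$ its numerators vanish, and for $t>0$ there are at
    -- least two letters.
    rcases Nat.eq_zero_or_pos t with h0 | hpos
    · subst h0
      field_simp
      ring
    · have : (C.card : ℚ) - 1 ≠ 0 := by
        have : (2 : ℚ) ≤ C.card := by exact_mod_cast (by omega : 2 ≤ C.card)
        linarith
      field_simp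
      ring

theorem ballotWords_eq_empty {t h : ℕ} {C : Multiset ℕ} (hC : 0 ∉ C) (ht : C.card < t) :
    ballotWords t h C = ∅ := by
  induction t generalizing h C with
  | zero => omega
  | succ t ih =>
    ext w
    cases w with
    | nil =>
      simp [ballotWords]
      intro _ _
      exact ⟨0, by omega⟩
    | cons a w =>
      rw [cons_mem_ballotWords_succ]
      simp only [Set.mem_empty_iff_false, iff_false]
      rintro ⟨-, ha, h⟩
      have := Multiset.card_erase_add_one ha
      rw [ih (fun h => hC (Multiset.mem_of_mem_erase h)) (by omega)] at h
      exact h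

/-! ### Non-crossing partitions and their words -/

section Words

variable {α : Type*} (e : α → ℕ)

/-- No two distinct blocks cross when the elements are ordered by `e`. -/
def NoncrossingBy (P : Finset (Finset α)) : Prop :=
  ∀ A ∈ P, ∀ B ∈ P, A ≠ B → ∀ a ∈ A, ∀ b ∈ B, ∀ c ∈ A, ∀ d ∈ B,
    e a < e b → e b < e c → ¬ e c < e d

open Classical in
/-- The size of `B` at its `e`-minimum, and `0` elsewhere. -/
noncomputable def minWeight (B : Finset α) (x : α) : ℕ :=
  if x ∈ B ∧ ∀ y ∈ B, e x ≤ e y then B.card else 0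

/-- The word of a family of blocks: the size of each block, placed at its `e`-minimum. -/
noncomputable def word (P : Finset (Finset α)) (x : α) : ℕ := ∑ B ∈ P, minWeight e B x

variable {e}

theorem minWeight_ne_zero {B : Finset α} {x : α} (h : minWeight e B x ≠ 0) :
    x ∈ B ∧ (∀ y ∈ B, e x ≤ e y) ∧ minWeight e B x = B.card := by
  unfold minWeight at h ⊢
  split_ifs at h ⊢ with h1
  · exact ⟨h1.1, h1.2, rfl⟩
  · exact absurd rfl h

theorem minWeight_of_isMin {B : Finset α} {x : α} (h : x ∈ B) (h' : ∀ y ∈ B, e x ≤ e y) :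
    minWeight e B x = B.card := if_pos ⟨h, h'⟩

theorem minWeight_of_ne (he : Function.Injective e) {B : Finset α} {x p : α} (hp : p ∈ B)
    (hp' : ∀ y ∈ B, e p ≤ e y) (h : x ≠ p) : minWeight e B x = 0 := by
  by_contra h1
  obtain ⟨h2, h3, -⟩ := minWeight_ne_zero h1
  exact h (he (le_antisymm (h3 p hp) (hp' x h2)))

theorem minWeight_of_notMem {B : Finset α} {x : α} (h : x ∉ B) : minWeight e B x = 0 := by
  by_contra h1
  exact h (minWeight_ne_zero h1).1

theorem exists_of_word_ne_zero {P : Finset (Finset α)} {x : α} (hx : word e P x ≠ 0) :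
    ∃ B ∈ P, x ∈ B ∧ ∀ y ∈ B, e x ≤ e y := by
  obtain ⟨B, hB, h⟩ := Finset.exists_ne_zero_of_sum_ne_zero hx
  exact ⟨B, hB, (minWeight_ne_zero h).1, (minWeight_ne_zero h).2.1⟩

variable [DecidableEq α] {S : Finset α}

theorem word_eq_minWeight (π : Finpartition S) {B : Finset α} (hB : B ∈ π.parts) {x : α}
    (hx : x ∈ B) : word e π.parts x = minWeight e B x := by
  refine Finset.sum_eq_single_of_mem B hB fun C hC hne => minWeight_of_notMem fun hxC => hne ?_
  exact π.eq_of_mem_parts hC hB hxC hx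

theorem word_eq_zero_of_notMem (π : Finpartition S) {x : α} (hx : x ∉ S) :
    word e π.parts x = 0 :=
  Finset.sum_eq_zero fun _ hB => minWeight_of_notMem fun h => hx (π.subset hB h)

theorem word_isMin (π : Finpartition S) {B : Finset α} (hB : B ∈ π.parts) {x : α}
    (hx : x ∈ B) (hx' : ∀ y ∈ B, e x ≤ e y) : word e π.parts x = B.card := by
  rw [word_eq_minWeight π hB hx, minWeight_of_isMin hx hx']

theorem exists_isMin (π : Finpartition S) {B : Finset α} (hB : B ∈ π.parts) :
    ∃ x ∈ B, (∀ y ∈ B, e x ≤ e y) ∧ word e π.parts x = B.card ∧ 0 < B.card := by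
  obtain ⟨x, hx, hx'⟩ := B.exists_min_image e (π.nonempty_of_mem_parts hB)
  exact ⟨x, hx, hx', word_isMin π hB hx hx', Finset.card_pos.2 ⟨x, hx⟩⟩

/-- A block meeting an initial segment has its minimum there, where its full size is recorded. -/
theorem card_filter_lt_le_sum_word (π : Finpartition S) (k : ℕ) :
    (S.filter (e · < k)).card ≤ ∑ y ∈ S with e y < k, word e π.parts y := by
  have h1 : S.filter (e · < k) ⊆ π.parts.biUnion (fun B => B.filter (e · < k)) := by
    intro x hx
    rw [Finset.mem_filter] at hx
    obtain ⟨B, hB, hxB⟩ := π.exists_mem hx.1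
    exact Finset.mem_biUnion.2 ⟨B, hB, Finset.mem_filter.2 ⟨hxB, hx.2⟩⟩
  refine (Finset.card_le_card h1).trans (Finset.card_biUnion_le.trans ?_)
  unfold word
  rw [Finset.sum_comm]
  refine Finset.sum_le_sum fun B hB => ?_
  rcases (B.filter (e · < k)).eq_empty_or_nonempty with h | ⟨y, hy⟩
  · simp [h]
  · obtain ⟨x, hx, hx', -⟩ := exists_isMin (e := e) π hB
    rw [Finset.mem_filter] at hy
    have hxk : x ∈ S.filter (e · < k) :=
      Finset.mem_filter.2 ⟨π.subset hB hx, (hx' y hy.1).trans_lt hy.2⟩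
    calc _ ≤ B.card := Finset.card_filter_le _ _
      _ = minWeight e B x := (minWeight_of_isMin hx hx').symm
      _ ≤ _ := Finset.single_le_sum (fun _ _ => Nat.zero_le _) hxk

theorem sum_word (he : Function.Injective e) (π : Finpartition S) :
    ∑ y ∈ S, word e π.parts y = S.card := by
  unfold word
  rw [Finset.sum_comm, ← π.sum_card_parts]
  refine Finset.sum_congr rfl fun B hB => ?_
  obtain ⟨x, hx, hx', -⟩ := exists_isMin (e := e) π hB
  rw [Finset.sum_eq_single_of_mem x (π.subset hB hx) fun y _ hy => minWeight_of_ne he hx hx' hy,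
    minWeight_of_isMin hx hx']

/-- The partition left after deleting the block `B`. -/
def eraseBlock (π : Finpartition S) {B : Finset α} (hB : B ∈ π.parts) : Finpartition (S \ B) :=
  π.ofSubset (Finset.erase_subset B π.parts) (by
    ext x
    simp only [Finset.mem_sup, Finset.mem_erase, id, Finset.mem_sdiff]
    constructor
    · rintro ⟨A, ⟨hne, hA⟩, hx⟩
      exact ⟨π.subset hA hx, fun h => hne (π.eq_of_mem_parts hA hB hx h)⟩
    · rintro ⟨hx, hxB⟩
      obtain ⟨A, hA, hxA⟩ := π.exists_mem hx
      exact ⟨A, ⟨fun h => hxB (h ▸ hxA), hA⟩, hxA⟩)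

/-- In a noncrossing partition the block that opens last is an interval. -/
theorem exists_last_block (he : Function.Injective e) (π : Finpartition S)
    (hπ : NoncrossingBy e π.parts) {p : α} (hp : word e π.parts p ≠ 0)
    (hlast : ∀ q ∈ S, word e π.parts q ≠ 0 → e q ≤ e p) :
    ∃ B ∈ π.parts, (∀ x ∈ B, e p ≤ e x) ∧ B.card = word e π.parts p ∧
      ∀ x ∈ B, ∀ y ∈ S, e p ≤ e y → y ∉ B → e x < e y := by
  obtain ⟨B, hB, hpB, hmin⟩ := exists_of_word_ne_zero hp
  refine ⟨B, hB, hmin, (word_isMin π hB hpB hmin).symm, fun x hx y hy hpy hyB => ?_⟩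
  by_contra hlt
  obtain ⟨C, hC, hyC⟩ := π.exists_mem hy
  have hCB : C ≠ B := fun h => hyB (h ▸ hyC)
  obtain ⟨q, hq, hq', hqw, hqc⟩ := exists_isMin (e := e) π hC
  have h1 := hlast q (π.subset hC hq) (by omega)
  have hqB : q ∉ B := fun h => hCB (π.eq_of_mem_parts hC hB hq h)
  have n1 : e q ≠ e p := fun h => hqB (he h ▸ hpB)
  have n2 : e p ≠ e y := fun h => hyB (he h ▸ hpB)
  have n3 : e y ≠ e x := fun h => hyB (he h ▸ hx)
  -- The block of `y` opens at `q`, before `p`; if `y` preceded `x`, then `q`, `p`, `y`, `x` would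
  -- be a crossing.
  exact hπ C hC B hB hCB q hq p hpB y hyC x hx (by omega) (by omega) (by omega)

theorem subset_or_subset_of_initial {T I J : Finset α} (hI : I ⊆ T) (hJ : J ⊆ T)
    (hI' : ∀ x ∈ I, ∀ y ∈ T, y ∉ I → e x < e y) (hJ' : ∀ x ∈ J, ∀ y ∈ T, y ∉ J → e x < e y) :
    I ⊆ J ∨ J ⊆ I := by
  by_contra! h
  obtain ⟨x, hx, hxJ⟩ := Finset.not_subset.1 h.1
  obtain ⟨y, hy, hyI⟩ := Finset.not_subset.1 h.2
  exact lt_asymm (hI' x hx y (hJ hy) hyI) (hJ' y hy x (hI hx) hxJ)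

theorem eq_of_initial {T I J : Finset α} (hI : I ⊆ T) (hJ : J ⊆ T)
    (hI' : ∀ x ∈ I, ∀ y ∈ T, y ∉ I → e x < e y) (hJ' : ∀ x ∈ J, ∀ y ∈ T, y ∉ J → e x < e y)
    (hc : I.card = J.card) : I = J := by
  rcases subset_or_subset_of_initial hI hJ hI' hJ' with h | h
  · exact Finset.eq_of_subset_of_card_le h hc.ge
  · exact (Finset.eq_of_subset_of_card_le h hc.le).symm

theorem exists_initial (he : Function.Injective e) (T : Finset α) (s : ℕ) (hs : s ≤ T.card) :
    ∃ I ⊆ T, I.card = s ∧ ∀ x ∈ I, ∀ y ∈ T, y ∉ I → e x < e y := by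
  induction s with
  | zero => exact ⟨∅, by simp, rfl, by simp⟩
  | succ s ih =>
    obtain ⟨I, hI, hc, h⟩ := ih (by omega)
    have hne : (T \ I).Nonempty := by
      rw [← Finset.card_pos, Finset.card_sdiff_of_subset hI]; omega
    obtain ⟨z, hz, hz'⟩ := (T \ I).exists_min_image e hne
    rw [Finset.mem_sdiff] at hz
    refine ⟨insert z I, Finset.insert_subset hz.1 hI, by rw [Finset.card_insert_of_notMem hz.2, hc],
      fun x hx y hy hyI => ?_⟩
    rw [Finset.mem_insert, not_or] at hyI
    rcases Finset.mem_insert.1 hx with rfl | hx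
    · exact lt_of_le_of_ne (hz' y (Finset.mem_sdiff.2 ⟨hy, hyI.2⟩)) fun h => hyI.1 (he h).symm
    · exact h x hx y hy hyI.2

/-- The last non-zero letter marks the start and gives the size of the block that opens last. That
block consists of the first elements from there on, so the word determines it; delete it and induct.
-/
theorem word_injective (he : Function.Injective e) (π ρ : Finpartition S)
    (hπ : NoncrossingBy e π.parts) (hρ : NoncrossingBy e ρ.parts)
    (h : word e π.parts = word e ρ.parts) : π.parts = ρ.parts := by
  induction hn : S.card using Nat.strong_induction_on generalizing S with
  | _ n ih =>
  rcases S.eq_empty_or_nonempty with rfl | hne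
  · rw [π.parts_eq_empty_iff.2 rfl, ρ.parts_eq_empty_iff.2 rfl]
  · have hne' : (S.filter (fun q => word e π.parts q ≠ 0)).Nonempty := by
      obtain ⟨B, hB⟩ := π.parts_nonempty hne.ne_empty
      obtain ⟨q, hq, -, h1, h2⟩ := exists_isMin (e := e) π hB
      exact ⟨q, Finset.mem_filter.2 ⟨π.subset hB hq, by omega⟩⟩
    obtain ⟨p, hp, hlast⟩ := Finset.exists_max_image _ e hne'
    rw [Finset.mem_filter] at hp
    obtain ⟨B, hB, b1, b2, b3⟩ := exists_last_block he π hπ hp.2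
      fun q hq hq' => hlast q (Finset.mem_filter.2 ⟨hq, hq'⟩)
    obtain ⟨C, hC, c1, c2, c3⟩ := exists_last_block he ρ hρ (h ▸ hp.2)
      fun q hq hq' => hlast q (Finset.mem_filter.2 ⟨hq, h ▸ hq'⟩)
    have hBC : B = C := by
      refine eq_of_initial (e := e) (T := S.filter (e p ≤ e ·))
        (fun x hx => Finset.mem_filter.2 ⟨π.subset hB hx, b1 x hx⟩)
        (fun x hx => Finset.mem_filter.2 ⟨ρ.subset hC hx, c1 x hx⟩) ?_ ?_ (by rw [b2, c2, h])
      · intro x hx y hy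
        rw [Finset.mem_filter] at hy
        exact b3 x hx y hy.1 hy.2
      · intro x hx y hy
        rw [Finset.mem_filter] at hy
        exact c3 x hx y hy.1 hy.2
    subst hBC
    have hlt : (S \ B).card < n := by
      rw [← hn]
      refine Finset.card_lt_card ⟨Finset.sdiff_subset, fun hs => ?_⟩
      obtain ⟨x, hx⟩ := π.nonempty_of_mem_parts hB
      exact (Finset.mem_sdiff.1 (hs (π.subset hB hx))).2 hx
    have key := ih _ hlt (eraseBlock π hB) (eraseBlock ρ hC)
      (fun A hA D hD => hπ A (Finset.mem_of_mem_erase hA) D (Finset.mem_of_mem_erase hD))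
      (fun A hA D hD => hρ A (Finset.mem_of_mem_erase hA) D (Finset.mem_of_mem_erase hD))
      (by
        funext x
        have h1 := Finset.sum_erase_add π.parts (fun A => minWeight e A x) hB
        have h2 := Finset.sum_erase_add ρ.parts (fun A => minWeight e A x) hC
        have h3 := congrFun h x
        simp only [word] at h3
        change ∑ A ∈ π.parts.erase B, minWeight e A x = ∑ A ∈ ρ.parts.erase B, minWeight e A x
        omega) rfl
    change π.parts.erase B = ρ.parts.erase B at key
    rw [← Finset.insert_erase hB, ← Finset.insert_erase hC, key]

/-- The inverse construction: at the last non-zero position `p`, the first `f p` elements from `p`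
on form a block. Clearing that letter leaves a smaller instance on the remaining elements. -/
theorem exists_word_eq (he : Function.Injective e) (S : Finset α) (f : α → ℕ)
    (hf : ∀ x ∉ S, f x = 0) (hsum : ∑ x ∈ S, f x = S.card)
    (hpre : ∀ k, (S.filter (e · < k)).card ≤ ∑ y ∈ S with e y < k, f y) :
    ∃ π : Finpartition S, NoncrossingBy e π.parts ∧ word e π.parts = f := by
  induction hn : S.card using Nat.strong_induction_on generalizing S f with
  | _ n ih =>
  rcases S.eq_empty_or_nonempty with rfl | hne
  · exact ⟨Finpartition.empty _, by intro A hA; exact absurd hA (by simp), by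
      funext x; rw [hf x (by simp)]; exact word_eq_zero_of_notMem (S := ∅) _ (by simp)⟩
  · have hne' : (S.filter (fun q => f q ≠ 0)).Nonempty := by
      have : ∑ x ∈ S, f x ≠ 0 := by rw [hsum]; exact (Finset.card_pos.2 hne).ne'
      obtain ⟨q, hq, hq'⟩ := Finset.exists_ne_zero_of_sum_ne_zero this
      exact ⟨q, Finset.mem_filter.2 ⟨hq, hq'⟩⟩
    obtain ⟨p, hp, hlast⟩ := Finset.exists_max_image _ e hne'
    rw [Finset.mem_filter] at hp
    have hafter : ∀ x, e p < e x → f x = 0 := by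
      intro x hx
      by_contra h
      have hxS : x ∈ S := by by_contra hxS; exact h (hf x hxS)
      exact absurd (hlast x (Finset.mem_filter.2 ⟨hxS, h⟩)) (by omega)
    -- The letters before `p` sum to at least the number of elements before `p`, and the totals
    -- agree, so there is room for the block.
    have hT : f p ≤ (S.filter (fun x => ¬ e x < e p)).card := by
      have h1 := Finset.card_filter_add_card_filter_not (s := S) (fun x => e x < e p)
      have h2 := Finset.sum_filter_add_sum_filter_not S (fun x => e x < e p) f
      have h3 : ∑ x ∈ S with ¬ e x < e p, f x = f p := by
        refine Finset.sum_eq_single_of_mem p (by simp [hp.1]) fun x hx hxp => hafter x ?_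
        rw [Finset.mem_filter] at hx
        have : e x ≠ e p := fun h => hxp (he h)
        omega
      have := hpre (e p)
      omega
    obtain ⟨I, hIT, hIc, hI⟩ := exists_initial he _ _ hT
    have hIS : I ⊆ S := hIT.trans (Finset.filter_subset _ _)
    have hIp : ∀ x ∈ I, e p ≤ e x := fun x hx => not_lt.1 (Finset.mem_filter.1 (hIT hx)).2
    have hpI : p ∈ I := by
      by_contra hpI
      have : I.Nonempty := Finset.card_pos.1 (by have := hp.2; omega)
      obtain ⟨x, hx⟩ := this
      exact absurd (hI x hx p (by simp [hp.1]) hpI) (not_lt.2 (hIp x hx))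
    have hI' : ∀ x ∈ I, ∀ y ∈ S \ I, e p ≤ e y → e x < e y := by
      intro x hx y hy hpy
      rw [Finset.mem_sdiff] at hy
      exact hI x hx y (Finset.mem_filter.2 ⟨hy.1, not_lt.2 hpy⟩) hy.2
    set g := Function.update f p 0 with hg
    have hgp : g p = 0 := by simp [hg]
    have hgx : ∀ x, x ≠ p → g x = f x := fun x hx => by simp [hg, hx]
    have hgI : ∀ x ∈ I, g x = 0 := by
      intro x hx
      by_cases hxp : x = p
      · rw [hxp, hgp]
      · rw [hgx x hxp]
        refine hafter x (lt_of_le_of_ne (hIp x hx) fun h => hxp (he h).symm)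
    have hg0 : ∀ x, e p ≤ e x → g x = 0 := by
      intro x hx
      by_cases hxp : x = p
      · rw [hxp, hgp]
      · rw [hgx x hxp]
        refine hafter x (lt_of_le_of_ne hx fun h => hxp (he h).symm)
    have hsub : ∀ k, ∑ x ∈ S \ I with e x < k, g x = ∑ x ∈ S with e x < k, g x := by
      intro k
      refine Finset.sum_subset (Finset.filter_subset_filter _ Finset.sdiff_subset) ?_
      intro x hx hx'
      rw [Finset.mem_filter] at hx hx'
      refine hgI x ?_
      by_contra hxI
      exact hx' ⟨Finset.mem_sdiff.2 ⟨hx.1, hxI⟩, hx.2⟩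
    have hsumg : ∑ x ∈ S \ I, g x = (S \ I).card := by
      have h1 : ∑ x ∈ S \ I, g x = ∑ x ∈ S, g x :=
        Finset.sum_subset Finset.sdiff_subset fun x hx hx' => hgI x (by
          by_contra hxI; exact hx' (Finset.mem_sdiff.2 ⟨hx, hxI⟩))
      have h2 : ∑ x ∈ S, g x + f p = ∑ x ∈ S, f x := by
        rw [← Finset.sum_erase_add S g hp.1, ← Finset.sum_erase_add S f hp.1, hgp, add_zero]
        congr 1
        exact Finset.sum_congr rfl fun x hx => hgx x (Finset.ne_of_mem_erase hx)
      rw [Finset.card_sdiff_of_subset hIS]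
      omega
    obtain ⟨ρ, hρ, hρw⟩ := ih (S \ I).card (by
        rw [← hn]
        exact Finset.card_lt_card ⟨Finset.sdiff_subset, fun hs =>
          (Finset.mem_sdiff.1 (hs hp.1)).2 hpI⟩) (S \ I) g
      (fun x hx => by
        by_cases hxI : x ∈ I
        · exact hgI x hxI
        · have hxS : x ∉ S := fun h => hx (Finset.mem_sdiff.2 ⟨h, hxI⟩)
          rw [hgx x fun h => hxI (h ▸ hpI), hf x hxS])
      hsumg
      -- Before `p` the letters are unchanged; beyond `p` the new word vanishes, so the partial sum
      -- is already the total.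
      (fun k => by
        rcases le_or_gt k (e p) with hk | hk
        · rw [hsub]
          refine (Finset.card_le_card
            (Finset.filter_subset_filter _ Finset.sdiff_subset)).trans ((hpre k).trans ?_)
          refine Finset.sum_le_sum fun x hx => ?_
          rw [Finset.mem_filter] at hx
          rw [hgx x fun h => by subst h; omega]
        · refine (Finset.card_le_card (Finset.filter_subset _ _)).trans ?_
          rw [← hsumg]
          refine (Finset.sum_subset (Finset.filter_subset _ _) fun x hx hx' => hg0 x ?_).ge
          rw [Finset.mem_filter, not_and] at hx'
          have := hx' hx
          omega) rfl
    have hIne : I ≠ ⊥ := Finset.ne_empty_of_mem hpI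
    refine ⟨ρ.extend hIne Finset.sdiff_disjoint (by simpa using hIS), ?_, ?_⟩
    · intro A hA B hB hAB a ha b hb c hc d hd h1 h2 h3
      change A ∈ insert I ρ.parts at hA
      change B ∈ insert I ρ.parts at hB
      rw [Finset.mem_insert] at hA hB
      -- No remaining element lies between two elements of `I`, so `I` crosses no other block.
      rcases hA with rfl | hA <;> rcases hB with rfl | hB
      · exact hAB rfl
      · have := hI' c hc b (ρ.subset hB hb) ((hIp a ha).trans h1.le)
        omega
      · have := hI' d hd c (ρ.subset hA hc) ((hIp b hb).trans h2.le)
        omega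
      · exact hρ A hA B hB hAB a ha b hb c hc d hd h1 h2 h3
    · funext x
      change ∑ B ∈ insert I ρ.parts, minWeight e B x = f x
      have hIρ : I ∉ ρ.parts := fun h => (Finset.mem_sdiff.1 (ρ.subset h hpI)).2 hpI
      rw [Finset.sum_insert hIρ]
      have := congrFun hρw x
      rw [word] at this
      rw [this]
      by_cases hxp : x = p
      · rw [hxp, hgp, minWeight_of_isMin hpI hIp, hIc, add_zero]
      · rw [minWeight_of_ne he hpI hIp hxp, hgx x hxp, zero_add]

end Words

theorem word_ne_zero_iff {α : Type*} [DecidableEq α] {e : α → ℕ} {S : Finset α}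
    (π : Finpartition S) {B : Finset α} (hB : B ∈ π.parts) {x : α} (hx : x ∈ B) :
    word e π.parts x ≠ 0 ↔ ∀ y ∈ B, e x ≤ e y := by
  rw [word_eq_minWeight π hB hx]
  refine ⟨fun h => (minWeight_ne_zero h).2.1, fun h => ?_⟩
  rw [minWeight_of_isMin hx h]
  exact (Finset.card_pos.2 ⟨x, hx⟩).ne'

/-- Each block contributes exactly one non-zero letter, at its minimum. -/
theorem card_filter_word_eq {α : Type*} [DecidableEq α] {e : α → ℕ} (he : Function.Injective e)
    {S : Finset α} (π : Finpartition S) {k : ℕ} (hk : k ≠ 0) :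
    (S.filter (fun x => word e π.parts x = k)).card =
      (π.parts.filter (fun B => B.card = k)).card := by
  have main : ∀ x ∈ S, word e π.parts x = k → π.part x ∈ π.parts ∧ x ∈ π.part x ∧
      (∀ y ∈ π.part x, e x ≤ e y) ∧ (π.part x).card = k := by
    intro x hx h
    have h1 := π.part_mem.2 hx
    have h2 := π.mem_part_self.2 hx
    have h3 := (word_ne_zero_iff π h1 h2).1 (h ▸ hk)
    exact ⟨h1, h2, h3, by rw [← h, word_isMin π h1 h2 h3]⟩
  refine Finset.card_bij (fun x _ => π.part x) ?_ ?_ ?_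
  · intro x hx
    rw [Finset.mem_filter] at hx
    obtain ⟨h1, -, -, h4⟩ := main x hx.1 hx.2
    exact Finset.mem_filter.2 ⟨h1, h4⟩
  · intro x hx y hy hxy
    rw [Finset.mem_filter] at hx hy
    obtain ⟨-, x2, x3, -⟩ := main x hx.1 hx.2
    obtain ⟨-, y2, y3, -⟩ := main y hy.1 hy.2
    exact he (le_antisymm (x3 y (hxy ▸ y2)) (y3 x (hxy ▸ x2)))
  · intro B hB
    rw [Finset.mem_filter] at hB
    obtain ⟨x, hx, -, h3, -⟩ := exists_isMin (e := e) π hB.1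
    exact ⟨x, Finset.mem_filter.2 ⟨π.subset hB.1 hx, h3.trans hB.2⟩,
      π.part_eq_of_mem hB.1 hx⟩

/-! ### Reversing $[t]$: from $t$-partitions to ordinary non-crossing -/

/-- The involution of `ℕ` that reverses `{1, …, t}`. -/
def flip (t x : ℕ) : ℕ := if 1 ≤ x ∧ x ≤ t then t + 1 - x else x

theorem flip_flip (t x : ℕ) : flip t (flip t x) = x := by
  unfold flip; split_ifs <;> omega

theorem flip_injective (t : ℕ) : Function.Injective (flip t) :=
  (show Function.Involutive (flip t) from flip_flip t).injective

theorem flip_mem_Icc {t N : ℕ} (h : t ≤ N) {x : ℕ} :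
    flip t x ∈ Finset.Icc 1 N ↔ x ∈ Finset.Icc 1 N := by
  unfold flip; rw [Finset.mem_Icc, Finset.mem_Icc]; split_ifs <;> omega

theorem IsTPartition.eq {t N : ℕ} {π : Finpartition (Finset.Icc 1 N)} (h : IsTPartition t π)
    {B : Finset ℕ} (hB : B ∈ π.parts) {x y : ℕ} (hx : x ∈ B) (hy : y ∈ B) (hxt : x ≤ t)
    (hyt : y ≤ t) : x = y := by
  have h1 := Finset.mem_Icc.1 (π.subset hB hx)
  have h2 := Finset.mem_Icc.1 (π.subset hB hy)
  exact Finset.card_le_one.1 (h B hB) x (by simp [hx, h1.1, hxt]) y (by simp [hy, h2.1, hyt])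

/-- In a flipped crossing $a,b,c,d$, having $c\le t$ would put $a,c\le t$ in one block; so $c,d>t$.
If $b\le t$ then also $a\le t$, and undoing the flip gives $b<a<c<d$, the first pattern; otherwise
the second arises. The converse reads this backwards. -/
theorem isNoncrossing_iff {t N : ℕ} {π : Finpartition (Finset.Icc 1 N)} (h : IsTPartition t π) :
    IsNoncrossing t π ↔ NoncrossingBy (flip t) π.parts := by
  constructor
  · intro hπ A hA B hB hAB a ha b hb c hc d hd h1 h2 h3
    have a0 := Finset.mem_Icc.1 (π.subset hA ha)
    have b0 := Finset.mem_Icc.1 (π.subset hB hb)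
    have c0 := Finset.mem_Icc.1 (π.subset hA hc)
    have d0 := Finset.mem_Icc.1 (π.subset hB hd)
    have hac : a ≤ t → c ≤ t → a = c := h.eq hA ha hc
    have hct : t < c := by
      by_contra hct
      have hat : a ≤ t := by
        unfold flip at h1 h2 h3; split_ifs at h1 h2 h3 <;> omega
      have := hac hat (by omega)
      subst this; omega
    have hdt : t < d := by
      unfold flip at h1 h2 h3; split_ifs at h1 h2 h3 <;> omega
    by_cases hbt : b ≤ t
    · refine hπ ⟨b, a, c, d, ?_, ?_, ?_, B, hB, A, hA, hAB.symm, Or.inl ⟨?_, hb, hd, ha, hc⟩⟩ <;>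
        (unfold flip at h1 h2 h3; split_ifs at h1 h2 h3 <;> omega)
    · refine hπ ⟨a, b, c, d, ?_, ?_, ?_, A, hA, B, hB, hAB, Or.inr ⟨?_, ha, hc, hb, hd⟩⟩ <;>
        (unfold flip at h1 h2 h3; split_ifs at h1 h2 h3 <;> omega)
  · rintro hπ ⟨i, j, k, l, hij, hjk, hkl, A, hA, B, hB, hAB,
      ⟨hj, hi, hl, hjB, hk⟩ | ⟨hj, hi, hk, hjB, hl⟩⟩
    · have i0 := Finset.mem_Icc.1 (π.subset hA hi)
      have hkt : t < k := by
        by_contra hkt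
        have := h.eq hB hjB hk hj (by omega)
        omega
      refine hπ B hB A hA hAB.symm j hjB i hi k hk l hl ?_ ?_ ?_ <;>
        (unfold flip; split_ifs <;> omega)
    · have i0 := Finset.mem_Icc.1 (π.subset hA hi)
      refine hπ A hA B hB hAB i hi j hjB k hk l hl ?_ ?_ ?_ <;>
        (unfold flip; split_ifs <;> omega)

/-- As $[t]$ comes first in the flipped order, an element of $[t]$ that is not minimal in its block
shares the block with another element of $[t]$. -/
theorem isTPartition_iff {t N : ℕ} (htN : t ≤ N) (π : Finpartition (Finset.Icc 1 N)) :
    IsTPartition t π ↔ ∀ x ∈ Finset.Icc 1 t, word (flip t) π.parts x ≠ 0 := by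
  constructor
  · intro h x hx
    rw [Finset.mem_Icc] at hx
    obtain ⟨B, hB, hxB⟩ := π.exists_mem (a := x) (Finset.mem_Icc.2 ⟨hx.1, hx.2.trans htN⟩)
    rw [word_ne_zero_iff π hB hxB]
    intro y hy
    by_contra hlt
    have := Finset.mem_Icc.1 (π.subset hB hy)
    have hyt : y ≤ t := by
      unfold flip at hlt; split_ifs at hlt <;> omega
    have := h.eq hB hxB hy hx.2 hyt
    subst this
    exact hlt le_rfl
  · intro h B hB
    refine Finset.card_le_one.2 fun x hx y hy => ?_
    rw [Finset.mem_inter] at hx hy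
    exact flip_injective t (le_antisymm ((word_ne_zero_iff π hB hx.1).1 (h x hx.2) y hy.1)
      ((word_ne_zero_iff π hB hy.1).1 (h y hy.2) x hx.1))

/-! ### The bijection with lists -/

/-- The letters of the word of `π`, listed in the order given by `flip t`. -/
noncomputable def letters (t : ℕ) {N : ℕ} (π : Finpartition (Finset.Icc 1 N)) : List ℕ :=
  (List.range N).map fun j => word (flip t) π.parts (flip t (j + 1))

/-- List position `j`, counted from 0, belongs to the element of flipped rank `j + 1`, hence the
strict bound `k + 1` for a prefix of length `k`. -/
theorem sum_flip_lt {t N k : ℕ} (htN : t ≤ N) (hk : k ≤ N) (f : ℕ → ℕ) :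
    ∑ y ∈ Finset.Icc 1 N with flip t y < k + 1, f y = ∑ j ∈ Finset.range k, f (flip t (j + 1)) := by
  symm
  refine Finset.sum_bij (fun j _ => flip t (j + 1)) ?_ ?_ ?_ ?_
  · intro j hj
    rw [Finset.mem_range] at hj
    rw [Finset.mem_filter, flip_mem_Icc htN, flip_flip, Finset.mem_Icc]
    omega
  · intro i _ j _ h
    have := flip_injective t h
    omega
  · intro y hy
    rw [Finset.mem_filter, ← flip_mem_Icc htN, Finset.mem_Icc] at hy
    refine ⟨flip t y - 1, by rw [Finset.mem_range]; omega, ?_⟩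
    rw [Nat.sub_add_cancel hy.1.1, flip_flip]
  · intro _ _; rfl

theorem card_flip_lt {t N k : ℕ} (htN : t ≤ N) (hk : k ≤ N) :
    ((Finset.Icc 1 N).filter (flip t · < k + 1)).card = k := by
  rw [Finset.card_eq_sum_ones, sum_flip_lt htN hk]; simp

theorem sum_flip {t N : ℕ} (htN : t ≤ N) (f : ℕ → ℕ) :
    ∑ y ∈ Finset.Icc 1 N, f y = ∑ j ∈ Finset.range N, f (flip t (j + 1)) := by
  rw [← sum_flip_lt htN le_rfl, Finset.filter_true_of_mem]
  intro y hy
  rw [← flip_mem_Icc htN, Finset.mem_Icc] at hy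
  omega

theorem sum_take_map_range (g : ℕ → ℕ) {k N : ℕ} (hk : k ≤ N) :
    (((List.range N).map g).take k).sum = ∑ j ∈ Finset.range k, g j := by
  rw [← List.map_take, List.take_range, min_eq_left hk]
  rfl

theorem ballot_map_range_iff {t N : ℕ} (htN : t ≤ N) (f : ℕ → ℕ) :
    Ballot 0 ((List.range N).map fun j => f (flip t (j + 1))) ↔
      (∀ k, ((Finset.Icc 1 N).filter (flip t · < k)).card ≤
        ∑ y ∈ Finset.Icc 1 N with flip t y < k, f y) ∧
      ∑ y ∈ Finset.Icc 1 N, f y = (Finset.Icc 1 N).card := by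
  have hsum : ((List.range N).map fun j => f (flip t (j + 1))).sum =
      ∑ y ∈ Finset.Icc 1 N, f y := by
    rw [sum_flip htN]; rfl
  rw [ballot_iff, hsum]
  simp only [List.length_map, List.length_range, zero_add, Nat.card_Icc, Nat.add_sub_cancel]
  refine and_congr_left fun hN => ⟨fun h k => ?_, fun h k hk => ?_⟩
  · rcases Nat.eq_zero_or_pos k with rfl | hk
    · simp
    · obtain ⟨k, rfl⟩ : ∃ j, k = j + 1 := ⟨k - 1, by omega⟩
      rcases le_or_gt k N with hkN | hkN
      · have := h k hkN
        rw [sum_take_map_range _ hkN] at this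
        rwa [card_flip_lt htN hkN, sum_flip_lt htN hkN]
      · have hall : ∀ y ∈ Finset.Icc 1 N, flip t y < k + 1 := fun y hy => by
          rw [← flip_mem_Icc htN, Finset.mem_Icc] at hy; omega
        rw [Finset.filter_true_of_mem hall, hN]
        simp
  · have := h (k + 1)
    rw [card_flip_lt htN hk, sum_flip_lt htN hk] at this
    rwa [sum_take_map_range _ hk]

theorem ballot_letters {t N : ℕ} (htN : t ≤ N) (π : Finpartition (Finset.Icc 1 N)) :
    Ballot 0 (letters t π) :=
  (ballot_map_range_iff htN _).2
    ⟨card_filter_lt_le_sum_word π, sum_word (flip_injective t) π⟩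

theorem count_map_range (g : ℕ → ℕ) (N k : ℕ) :
    ((List.range N).map g).count k = ∑ j ∈ Finset.range N, if g j = k then 1 else 0 := by
  induction N with
  | zero => simp
  | succ N ih =>
    rw [List.range_succ, List.map_append, List.count_append, ih, Finset.sum_range_succ]
    simp [List.count_singleton]

theorem count_letters {t N : ℕ} (htN : t ≤ N) (π : Finpartition (Finset.Icc 1 N)) {k : ℕ}
    (hk : k ≠ 0) : (letters t π).count k = blocksOfSize π k := by
  rw [blocksOfSize, ← card_filter_word_eq (flip_injective t) π hk, Finset.card_filter,
    sum_flip htN, letters, count_map_range]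

theorem getD_letters {t N : ℕ} (π : Finpartition (Finset.Icc 1 N)) {j : ℕ} (hj : j < N) :
    (letters t π).getD j 0 = word (flip t) π.parts (flip t (j + 1)) := by
  simp [letters, hj]

theorem letters_injective {t N : ℕ} (htN : t ≤ N) {π ρ : Finpartition (Finset.Icc 1 N)}
    (hπ : NoncrossingBy (flip t) π.parts) (hρ : NoncrossingBy (flip t) ρ.parts)
    (h : letters t π = letters t ρ) : π = ρ := by
  refine Finpartition.ext (word_injective (flip_injective t) π ρ hπ hρ (funext fun x => ?_))
  by_cases hx : x ∈ Finset.Icc 1 N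
  · have hx' := hx
    rw [← flip_mem_Icc htN, Finset.mem_Icc] at hx'
    have h1 := congrArg (fun l => l.getD (flip t x - 1) 0) h
    rwa [getD_letters π (by omega), getD_letters ρ (by omega), Nat.sub_add_cancel hx'.1,
      flip_flip] at h1
  · rw [word_eq_zero_of_notMem π hx, word_eq_zero_of_notMem ρ hx]

theorem exists_letters_eq {t : ℕ} {w : List ℕ} (htN : t ≤ w.length) (hw : Ballot 0 w) :
    ∃ π : Finpartition (Finset.Icc 1 w.length),
      NoncrossingBy (flip t) π.parts ∧ letters t π = w := by
  -- The guard matters at `x = 0`, where truncated subtraction would read the first letter.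
  set f : ℕ → ℕ := fun x => if 1 ≤ x then w.getD (flip t x - 1) 0 else 0 with hf
  have hflip : ∀ j, 1 ≤ flip t (j + 1) := by
    intro j; unfold flip; split_ifs <;> omega
  have hfw : ∀ j, f (flip t (j + 1)) = w.getD j 0 := by
    intro j; simp only [hf, hflip, if_true, flip_flip, Nat.add_sub_cancel]
  have hmap : ((List.range w.length).map fun j => f (flip t (j + 1))) = w := by
    simp only [hfw]
    refine List.ext_getElem (by simp) fun i h1 h2 => ?_
    simp [h2]
  have hb := (ballot_map_range_iff htN f).1 (hmap.symm ▸ hw)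
  obtain ⟨π, hπ, hπw⟩ := exists_word_eq (flip_injective t) (Finset.Icc 1 w.length) f
    (fun x hx => by
      simp only [hf]
      split_ifs with h1
      · rw [← flip_mem_Icc htN, Finset.mem_Icc] at hx
        have : 1 ≤ flip t x := by unfold flip; split_ifs <;> omega
        exact List.getD_eq_default _ _ (by omega)
      · rfl) hb.2 hb.1
  exact ⟨π, hπ, by rw [letters, hπw, hmap]⟩

theorem mem_NC_iff {m n t : ℕ} (htmn : t ≤ m * n) (π : Finpartition (Finset.Icc 1 (m * n))) :
    π ∈ NC m n t ↔ NoncrossingBy (flip t) π.parts ∧ IsDivisible m π ∧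
      ∀ i < t, (letters t π).getD i 0 ≠ 0 := by
  have key : IsTPartition t π ↔ ∀ i < t, (letters t π).getD i 0 ≠ 0 := by
    rw [isTPartition_iff htmn]
    constructor
    · intro h i hi
      rw [getD_letters π (by omega)]
      exact h _ (by rw [flip_mem_Icc le_rfl, Finset.mem_Icc]; omega)
    · intro h x hx
      rw [← flip_mem_Icc le_rfl, Finset.mem_Icc] at hx
      have := h (flip t x - 1) (by omega)
      rwa [getD_letters π (by omega), Nat.sub_add_cancel hx.1, flip_flip] at this
  rw [← key]
  constructor
  · rintro ⟨h1, h2, h3⟩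
    exact ⟨(isNoncrossing_iff h2).1 h3, h1, h2⟩
  · rintro ⟨h1, h2, h3⟩
    exact ⟨h2, h3, (isNoncrossing_iff h3).2 h1⟩

/-! ### Prescribed block sizes -/

/-- The block sizes, with multiplicity, of a partition with `ν i` blocks of size `m * i`. -/
def blockSizes (m n : ℕ) (ν : ℕ → ℕ) : Multiset ℕ :=
  ∑ i ∈ Finset.Icc 1 n, Multiset.replicate (ν i) (m * i)

section BlockSizes

variable {m n : ℕ} {ν : ℕ → ℕ}

theorem card_blockSizes : (blockSizes m n ν).card = ∑ i ∈ Finset.Icc 1 n, ν i := by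
  simp [blockSizes]

theorem sum_blockSizes : (blockSizes m n ν).sum = m * ∑ i ∈ Finset.Icc 1 n, i * ν i := by
  rw [blockSizes, Multiset.sum_sum, Finset.mul_sum]
  refine Finset.sum_congr rfl fun i _ => ?_
  simp; ring

theorem mem_blockSizes {k : ℕ} (h : k ∈ blockSizes m n ν) :
    ∃ i ∈ Finset.Icc 1 n, k = m * i := by
  rw [blockSizes, Multiset.mem_sum] at h
  obtain ⟨i, hi, hk⟩ := h
  exact ⟨i, hi, Multiset.eq_of_mem_replicate hk⟩

theorem zero_notMem_blockSizes (hm : 0 < m) : 0 ∉ blockSizes m n ν := by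
  intro h
  obtain ⟨i, hi, h0⟩ := mem_blockSizes h
  have := Finset.mem_Icc.1 hi
  exact (Nat.mul_pos hm this.1).ne h0

theorem count_blockSizes (hm : 0 < m) {i : ℕ} (hi : i ∈ Finset.Icc 1 n) :
    (blockSizes m n ν).count (m * i) = ν i := by
  rw [blockSizes, Multiset.count_sum', Finset.sum_eq_single_of_mem i hi]
  · simp
  · intro j _ hj
    rw [Multiset.count_replicate, if_neg]
    exact fun h => hj (Nat.eq_of_mul_eq_mul_left hm h)

theorem countPerms_blockSizes (hm : 0 < m) :
    (blockSizes m n ν).countPerms = Nat.multinomial (Finset.Icc 1 n) ν := by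
  have hinj : Set.InjOn (m * ·) (Finset.Icc 1 n : Set ℕ) :=
    fun i _ j _ h => Nat.eq_of_mul_eq_mul_left hm h
  rw [Multiset.countPerms, Finsupp.multinomial_eq_of_support_subset
    (s := (Finset.Icc 1 n).image (m * ·)), Nat.multinomial, Nat.multinomial,
    Finset.sum_image hinj, Finset.prod_image hinj]
  · congr 1
    · congr 1
      exact Finset.sum_congr rfl fun i hi => count_blockSizes hm hi
    · exact Finset.prod_congr rfl fun i hi => congrArg _ (count_blockSizes hm hi)
  · intro k hk
    rw [Multiset.toFinsupp_support, Multiset.mem_toFinset] at hk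
    obtain ⟨i, hi, rfl⟩ := mem_blockSizes hk
    exact Finset.mem_image_of_mem _ hi

end BlockSizes

theorem IsDivisible.exists_card_eq {m n : ℕ} {π : Finpartition (Finset.Icc 1 (m * n))}
    (hm : 0 < m) (h : IsDivisible m π) {B : Finset ℕ} (hB : B ∈ π.parts) :
    ∃ i ∈ Finset.Icc 1 n, B.card = m * i := by
  obtain ⟨i, hi⟩ := h B hB
  have h1 : 0 < B.card := Finset.card_pos.2 (π.nonempty_of_mem_parts hB)
  have h2 : B.card ≤ m * n := by simpa using Finset.card_le_card (π.subset hB)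
  rw [hi] at h1 h2
  exact ⟨i, Finset.mem_Icc.2 ⟨Nat.pos_of_mul_pos_left h1, Nat.le_of_mul_le_mul_left h2 hm⟩, hi⟩

theorem IsDivisible.sum_parts {m n : ℕ} {π : Finpartition (Finset.Icc 1 (m * n))}
    (hm : 0 < m) (h : IsDivisible m π) (g : ℕ → ℕ) :
    ∑ B ∈ π.parts, g B.card = ∑ i ∈ Finset.Icc 1 n, blocksOfSize π (m * i) * g (m * i) := by
  have hinj : Set.InjOn (m * ·) (Finset.Icc 1 n : Set ℕ) :=
    fun i _ j _ h => Nat.eq_of_mul_eq_mul_left hm h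
  rw [← Finset.sum_image (f := fun k => blocksOfSize π k * g k) hinj,
    ← Finset.sum_fiberwise_of_maps_to (g := Finset.card) (t := (Finset.Icc 1 n).image (m * ·))]
  · refine Finset.sum_congr rfl fun k _ => ?_
    rw [Finset.sum_congr rfl (g := fun _ => g k), Finset.sum_const, smul_eq_mul, blocksOfSize]
    intro B hB
    rw [(Finset.mem_filter.1 hB).2]
  · intro B hB
    obtain ⟨i, hi, hBi⟩ := h.exists_card_eq hm hB
    rw [hBi]
    exact Finset.mem_image_of_mem _ hi

theorem IsDivisible.sum_mul_blocksOfSize {m n : ℕ} {π : Finpartition (Finset.Icc 1 (m * n))}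
    (hm : 0 < m) (h : IsDivisible m π) :
    ∑ i ∈ Finset.Icc 1 n, i * blocksOfSize π (m * i) = n := by
  have h1 := h.sum_parts hm id
  simp only [id, π.sum_card_parts, Nat.card_Icc, Nat.add_sub_cancel] at h1
  refine Nat.eq_of_mul_eq_mul_left hm ?_
  refine Eq.trans ?_ h1.symm
  rw [Finset.mul_sum]
  exact Finset.sum_congr rfl fun i _ => by ring

theorem IsDivisible.card_parts {m n : ℕ} {π : Finpartition (Finset.Icc 1 (m * n))}
    (hm : 0 < m) (h : IsDivisible m π) :
    π.parts.card = ∑ i ∈ Finset.Icc 1 n, blocksOfSize π (m * i) := by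
  simpa using h.sum_parts hm fun _ => 1

/-- The non-zero letters are the block sizes, so prescribing them as multiples of $m$ also enforces
divisibility. -/
theorem filter_letters_eq {m n t : ℕ} (hm : 0 < m) (htmn : t ≤ m * n)
    (π : Finpartition (Finset.Icc 1 (m * n))) (ν : ℕ → ℕ) :
    (↑((letters t π).filter (· ≠ 0)) : Multiset ℕ) = blockSizes m n ν ↔
      IsDivisible m π ∧ ∀ i ∈ Finset.Icc 1 n, blocksOfSize π (m * i) = ν i := by
  have hcount : ∀ k ≠ 0, Multiset.count k (↑((letters t π).filter (· ≠ 0)) : Multiset ℕ) =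
      blocksOfSize π k := by
    intro k hk
    rw [Multiset.coe_count, List.count_filter (by simpa using hk), count_letters htmn π hk]
  have hpos : ∀ i ∈ Finset.Icc 1 n, m * i ≠ 0 := fun i hi =>
    (Nat.mul_pos hm (Finset.mem_Icc.1 hi).1).ne'
  constructor
  · intro h
    constructor
    · intro B hB
      have hBc : B.card ≠ 0 := (Finset.card_pos.2 (π.nonempty_of_mem_parts hB)).ne'
      have h1 : 0 < blocksOfSize π B.card := Finset.card_pos.2 ⟨B, by simp [hB]⟩
      rw [← hcount _ hBc, h, Multiset.count_pos] at h1
      obtain ⟨i, -, hi⟩ := mem_blockSizes h1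
      exact ⟨i, hi⟩
    · intro i hi
      rw [← hcount _ (hpos i hi), h, count_blockSizes hm hi]
  · rintro ⟨h1, h2⟩
    ext k
    by_cases hk : k = 0
    · subst hk
      rw [Multiset.count_eq_zero.2 (zero_notMem_blockSizes hm), Multiset.count_eq_zero]
      simp
    · rw [hcount k hk]
      by_cases hi : ∃ i ∈ Finset.Icc 1 n, k = m * i
      · obtain ⟨i, hi, rfl⟩ := hi
        rw [count_blockSizes hm hi, h2 i hi]
      · rw [Multiset.count_eq_zero.2 fun h => hi (mem_blockSizes h), blocksOfSize,
          Finset.card_eq_zero, Finset.filter_eq_empty_iff]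
        rintro B hB rfl
        exact hi (h1.exists_card_eq hm hB)

/-- The `m`-divisible noncrossing `t`-partitions with `ν i` blocks of size `m * i`. -/
abbrev NCOfType (m n t : ℕ) (ν : ℕ → ℕ) : Set (Finpartition (Finset.Icc 1 (m * n))) :=
  {π ∈ NC m n t | ∀ i ∈ Finset.Icc 1 n, blocksOfSize π (m * i) = ν i}

/-- The condition on `ν` fixes the word length at $mn$, so that every ballot word comes from a
partition of $[mn]$. -/
theorem ncard_NCOfType_eq_ncard_ballotWords {m n t : ℕ} (hm : 0 < m) (htmn : t ≤ m * n)
    {ν : ℕ → ℕ} (hν : ∑ i ∈ Finset.Icc 1 n, i * ν i = n) :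
    (NCOfType m n t ν).ncard = (ballotWords t 0 (blockSizes m n ν)).ncard := by
  have hmem : ∀ π : Finpartition (Finset.Icc 1 (m * n)), π ∈ NCOfType m n t ν ↔
      NoncrossingBy (flip t) π.parts ∧ letters t π ∈ ballotWords t 0 (blockSizes m n ν) := by
    intro π
    have h1 := ballot_letters htmn π
    have h2 := filter_letters_eq hm htmn π ν
    have h3 := mem_NC_iff htmn π
    rw [ballotWords, Set.mem_ofPred_eq, Set.mem_ofPred_eq, h2, h3]
    tauto
  refine Set.ncard_congr (fun π _ => letters t π) (fun π hπ => ((hmem π).1 hπ).2)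
    (fun π ρ hπ hρ h => letters_injective htmn ((hmem π).1 hπ).1 ((hmem ρ).1 hρ).1 h) ?_
  intro w hw
  have hlen : w.length = m * n := by
    rw [length_of_mem_ballotWords hw, sum_blockSizes, hν, zero_add]
  have : ∃ π : Finpartition (Finset.Icc 1 (m * n)),
      NoncrossingBy (flip t) π.parts ∧ letters t π = w := by
    rw [← hlen]
    exact exists_letters_eq (hlen ▸ htmn) hw.2.1
  obtain ⟨π, hπ, rfl⟩ := this
  exact ⟨π, (hmem π).2 ⟨hπ, hw⟩, rfl⟩

theorem binom_sub (N b t : ℕ) (h : t ≤ b) : binom N ((b : ℤ) - t) = N.choose (b - t) := by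
  rw [← Nat.cast_sub h, binom, if_pos (by positivity), Int.toNat_natCast]

theorem binom_of_lt (N b t : ℕ) (h : b < t) : binom N ((b : ℤ) - t) = 0 :=
  if_neg (by omega)

theorem ncard_NCOfType {m n t : ℕ} (hm : 0 < m) (hn : 0 < n) (htmn : t ≤ m * n)
    {ν : ℕ → ℕ} (hν : ∑ i ∈ Finset.Icc 1 n, i * ν i = n) :
    ((NCOfType m n t ν).ncard : ℚ) =
      (((m : ℚ) * n - t + 1) * (∑ i ∈ Finset.Icc 1 n, ν i : ℕ)
          - (m : ℚ) * n * ((∑ i ∈ Finset.Icc 1 n, ν i : ℕ) - (t : ℚ))) /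
        (((m : ℚ) * n - t + 1) * (∑ i ∈ Finset.Icc 1 n, ν i : ℕ)) *
      binom (m * n - t + 1) (((∑ i ∈ Finset.Icc 1 n, ν i : ℕ) : ℤ) - t) *
      Nat.multinomial (Finset.Icc 1 n) ν := by
  have hC := zero_notMem_blockSizes (n := n) (ν := ν) hm
  have hc := card_blockSizes (m := m) (n := n) (ν := ν)
  rw [ncard_NCOfType_eq_ncard_ballotWords hm htmn hν]
  have hb : ∑ i ∈ Finset.Icc 1 n, ν i ≠ 0 := by
    intro h0
    rw [Finset.sum_eq_zero_iff] at h0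
    rw [Finset.sum_eq_zero fun i hi => by rw [h0 i hi, mul_zero]] at hν
    omega
  set b := ∑ i ∈ Finset.Icc 1 n, ν i
  -- With fewer than $t$ blocks there are too few non-zero letters, and the binomial has negative
  -- lower index.
  rcases lt_or_ge b t with hbt | hbt
  · rw [ballotWords_eq_empty hC (hc ▸ hbt), binom_of_lt _ _ _ hbt]
    simp
  · have key := ncard_ballotWords t 0 _ hC (hc ▸ hbt)
    rw [hc, sum_blockSizes, hν, countPerms_blockSizes hm, zero_add] at key
    rw [binom_sub _ _ _ hbt]
    have hM : (m : ℚ) * n - t + 1 ≠ 0 := by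
      have : (t : ℚ) ≤ m * n := by exact_mod_cast htmn
      linarith
    have hbq : (b : ℚ) ≠ 0 := by exact_mod_cast hb
    push_cast at key
    rw [zero_add] at key
    refine mul_right_cancel₀ hM ?_
    rw [key]
    field_simp
    ring

theorem NCOfType_eq_empty {m n t : ℕ} (hm : 0 < m) {ν : ℕ → ℕ}
    (hν : ∑ i ∈ Finset.Icc 1 n, i * ν i ≠ n) : NCOfType m n t ν = ∅ := by
  rw [Set.eq_empty_iff_forall_notMem]
  rintro π ⟨hπ, h⟩
  refine hν ?_
  refine Eq.trans ?_ (hπ.1.sum_mul_blocksOfSize hm)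
  exact Finset.sum_congr rfl fun i hi => by rw [h i hi]

/-! ### Summing multinomials over block types -/

section Compositions

open Polynomial

/-- A subtraction-free geometric series; up to degree $n$ it reads $P=X+XP$, the source of Pascal's
rule for the coefficients of powers of $P$. -/
theorem sum_X_pow_add (n : ℕ) :
    (∑ i ∈ Finset.Icc 1 n, X ^ i : ℕ[X]) + X ^ (n + 1) = X + X * ∑ i ∈ Finset.Icc 1 n, X ^ i := by
  induction n with
  | zero => simp
  | succ n ih =>
    rw [Finset.sum_Icc_succ_top (by omega), mul_add, ← add_assoc, ← ih, pow_succ' X (n + 1)]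

theorem coeff_zero_sum_X_pow_pow (n b : ℕ) :
    ((∑ i ∈ Finset.Icc 1 n, X ^ i : ℕ[X]) ^ (b + 1)).coeff 0 = 0 := by
  have h := congrArg (fun p => (p * (∑ i ∈ Finset.Icc 1 n, X ^ i : ℕ[X]) ^ b).coeff 0)
    (sum_X_pow_add n)
  simp only [add_mul, coeff_add, mul_assoc, coeff_X_mul_zero, pow_succ' X n] at h
  rw [pow_succ']
  omega

/-- The coefficient counts compositions of $j+1$ into $b+1$ parts; as $j+1\le n$, the bound $n$ on
the parts has no effect. -/
theorem coeff_succ_sum_X_pow_pow {n b j : ℕ} (hj : j < n) :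
    ((∑ i ∈ Finset.Icc 1 n, X ^ i : ℕ[X]) ^ (b + 1)).coeff (j + 1) = j.choose b := by
  have hrec : ∀ b j, j < n → ((∑ i ∈ Finset.Icc 1 n, X ^ i : ℕ[X]) ^ (b + 1)).coeff (j + 1) =
      ((∑ i ∈ Finset.Icc 1 n, X ^ i : ℕ[X]) ^ b).coeff j +
      ((∑ i ∈ Finset.Icc 1 n, X ^ i : ℕ[X]) ^ (b + 1)).coeff j := by
    intro b j hj
    have h := congrArg (fun p => (p * (∑ i ∈ Finset.Icc 1 n, X ^ i : ℕ[X]) ^ b).coeff (j + 1))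
      (sum_X_pow_add n)
    simp only [add_mul, coeff_add, mul_assoc, coeff_X_mul] at h
    rw [coeff_X_pow_mul', if_neg (by omega), add_zero] at h
    rw [pow_succ', h]
  induction j generalizing b with
  | zero =>
    rw [hrec b 0 hj, coeff_zero_sum_X_pow_pow]
    cases b with
    | zero => simp
    | succ b => rw [coeff_zero_sum_X_pow_pow]; simp
  | succ j ih =>
    rw [hrec b _ hj, ih (by omega)]
    cases b with
    | zero => simp [coeff_one]
    | succ b => rw [ih (by omega), Nat.choose_succ_succ]

/-- The types of partitions of `m * n` into `b` blocks of sizes `m, 2 * m, …, n * m`. -/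
def blockTypes (n b : ℕ) : Finset (ℕ → ℕ) :=
  (Finset.piAntidiag (Finset.Icc 1 n) b).filter fun ν => ∑ i ∈ Finset.Icc 1 n, i * ν i = n

theorem sum_multinomial_blockTypes (n b : ℕ) :
    ∑ ν ∈ blockTypes n b, Nat.multinomial (Finset.Icc 1 n) ν =
      ((∑ i ∈ Finset.Icc 1 n, X ^ i : ℕ[X]) ^ b).coeff n := by
  rw [Finset.sum_pow_eq_sum_piAntidiag, finsetSum_coeff, blockTypes, Finset.sum_filter]
  refine Finset.sum_congr rfl fun ν _ => ?_
  simp only [← pow_mul, Finset.prod_pow_eq_pow_sum]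
  rw [coeff_natCast_mul, coeff_X_pow]
  simp [eq_comm]

theorem mul_sum_multinomial_blockTypes {n : ℕ} (hn : 0 < n) (b : ℕ) :
    n * ∑ ν ∈ blockTypes n b, Nat.multinomial (Finset.Icc 1 n) ν = b * n.choose b := by
  rw [sum_multinomial_blockTypes]
  obtain ⟨n, rfl⟩ : ∃ k, n = k + 1 := ⟨n - 1, by omega⟩
  cases b with
  | zero => simp [coeff_one]
  | succ b =>
    rw [coeff_succ_sum_X_pow_pow (by omega), Nat.add_one_mul_choose_eq]
    ring

end Compositions

/-! ### Prescribed number of blocks, and the total -/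

theorem setOf_card_parts_eq {m n t b : ℕ} (hm : 0 < m) :
    {π ∈ NC m n t | π.parts.card = b} =
      ⋃ ν ∈ (blockTypes n b : Set (ℕ → ℕ)), NCOfType m n t ν := by
  ext π
  simp only [Set.mem_iUnion, exists_prop, Finset.mem_coe, blockTypes, Finset.mem_filter,
    Finset.mem_piAntidiag, Set.mem_ofPred_eq]
  constructor
  · rintro ⟨hπ, hb⟩
    have hcongr : ∀ i ∈ Finset.Icc 1 n, blocksOfSize π (m * i) =
        if i ∈ Finset.Icc 1 n then blocksOfSize π (m * i) else 0 := fun i hi => (if_pos hi).symm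
    -- `Finset.piAntidiag` requires the type to vanish outside $[n]$, hence the cut-off.
    refine ⟨fun i => if i ∈ Finset.Icc 1 n then blocksOfSize π (m * i) else 0,
      ⟨⟨?_, fun i hi => by by_contra h; exact hi (if_neg h)⟩, ?_⟩, hπ, hcongr⟩
    · rw [← Finset.sum_congr rfl hcongr, ← hπ.1.card_parts hm, hb]
    · refine Eq.trans ?_ (hπ.1.sum_mul_blocksOfSize hm)
      exact Finset.sum_congr rfl fun i hi => congrArg _ (hcongr i hi).symm
  · rintro ⟨ν, ⟨⟨h1, -⟩, -⟩, hπ, h2⟩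
    refine ⟨hπ, ?_⟩
    rw [hπ.1.card_parts hm, Finset.sum_congr rfl h2, ← h1]

theorem ncard_card_parts_eq_sum {m n t : ℕ} (b : ℕ) (hm : 0 < m) :
    {π ∈ NC m n t | π.parts.card = b}.ncard =
      ∑ ν ∈ blockTypes n b, (NCOfType m n t ν).ncard := by
  rw [setOf_card_parts_eq hm, Set.Finite.ncard_biUnion (Finset.finite_toSet _)
    (fun _ _ => Set.toFinite _), finsum_mem_coe_finset]
  intro ν hν μ hμ hne
  rw [Function.onFun, Set.disjoint_left]
  rintro π ⟨-, h1⟩ ⟨-, h2⟩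
  refine hne (funext fun i => ?_)
  by_cases hi : i ∈ Finset.Icc 1 n
  · rw [← h1 i hi, ← h2 i hi]
  · simp only [blockTypes, Finset.coe_filter, Set.mem_ofPred_eq, Finset.mem_piAntidiag] at hν hμ
    have a1 : ν i = 0 := by by_contra h; exact hi (hν.1.2 i h)
    have a2 : μ i = 0 := by by_contra h; exact hi (hμ.1.2 i h)
    rw [a1, a2]

theorem ncard_card_parts {m n t : ℕ} (hm : 0 < m) (hn : 0 < n) (ht : 0 < t) (htmn : t ≤ m * n)
    (b : ℕ) :
    ({π ∈ NC m n t | π.parts.card = b}.ncard : ℚ) =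
      ((m : ℚ) * n * t - b * ((t : ℚ) - 1)) / (n * ((m : ℚ) * n - t + 1)) *
        binom (m * n - t + 1) ((b : ℤ) - t) * n.choose b := by
  rw [ncard_card_parts_eq_sum b hm]
  push_cast
  have h1 : ∀ ν ∈ blockTypes n b, ((NCOfType m n t ν).ncard : ℚ) =
      (((m : ℚ) * n - t + 1) * b - (m : ℚ) * n * (b - (t : ℚ))) / (((m : ℚ) * n - t + 1) * b) *
        binom (m * n - t + 1) ((b : ℤ) - t) * Nat.multinomial (Finset.Icc 1 n) ν := by
    intro ν hν
    rw [blockTypes, Finset.mem_filter, Finset.mem_piAntidiag] at hν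
    have := ncard_NCOfType hm hn htmn hν.2
    rwa [show ∑ i ∈ Finset.Icc 1 n, ν i = b from hν.1.1] at this
  rw [Finset.sum_congr rfl h1, ← Finset.mul_sum]
  have h2 : (n : ℚ) * ∑ ν ∈ blockTypes n b, (Nat.multinomial (Finset.Icc 1 n) ν : ℚ) =
      b * n.choose b := by exact_mod_cast mul_sum_multinomial_blockTypes hn b
  have hnq : (n : ℚ) ≠ 0 := by positivity
  have hM : (m : ℚ) * n - t + 1 ≠ 0 := by
    have : (t : ℚ) ≤ m * n := by exact_mod_cast htmn
    linarith
  -- For $b=0$ the quotient by $b$ is meaningless, but $t>0$ makes the binomial vanish.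
  rcases Nat.eq_zero_or_pos b with rfl | hb
  · rw [binom_of_lt _ _ _ ht]; simp
  · have hbq : (b : ℚ) ≠ 0 := by positivity
    rw [eq_div_of_mul_eq hnq ((mul_comm _ _).trans h2)]
    field_simp
    ring

theorem sum_binom_mul_choose {n t : ℕ} (M : ℕ) (htn : t ≤ n) :
    ∑ b ∈ Finset.range (n + 1), binom M ((b : ℤ) - t) * n.choose b = (M + n).choose (n - t) := by
  rw [Nat.add_choose_eq, Finset.Nat.sum_antidiagonal_eq_sum_range_succ
    (fun i j => M.choose i * n.choose j), show n + 1 = t + (n - t + 1) by omega,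
    Finset.sum_range_add, Finset.sum_eq_zero, zero_add]
  · refine Finset.sum_congr rfl fun i hi => ?_
    rw [Finset.mem_range] at hi
    rw [binom_sub _ _ _ (by omega), Nat.add_sub_cancel_left,
      ← Nat.choose_symm (n := n) (k := t + i) (by omega), Nat.sub_sub]
  · intro b hb
    rw [binom_of_lt _ _ _ (Finset.mem_range.1 hb), zero_mul]

/-- Absorption, $b\binom nb=n\binom{n-1}{b-1}$, lowers $n$ and $t$ by one and reduces this to the
previous Vandermonde sum. -/
theorem sum_mul_binom_mul_choose {n t : ℕ} (M : ℕ) (ht : 0 < t) (htn : t ≤ n) :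
    ∑ b ∈ Finset.range (n + 1), b * (binom M ((b : ℤ) - t) * n.choose b) =
      n * (M + n - 1).choose (n - t) := by
  obtain ⟨n, rfl⟩ : ∃ k, n = k + 1 := ⟨n - 1, by omega⟩
  obtain ⟨t, rfl⟩ : ∃ k, t = k + 1 := ⟨t - 1, by omega⟩
  rw [Finset.sum_range_succ', zero_mul, add_zero, Nat.add_sub_add_right, ← add_assoc,
    Nat.add_sub_cancel, ← sum_binom_mul_choose M (by omega : t ≤ n), Finset.mul_sum]
  refine Finset.sum_congr rfl fun b _ => ?_
  have := Nat.add_one_mul_choose_eq n b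
  push_cast
  rw [add_sub_add_right_eq_sub]
  linear_combination binom M ((b : ℤ) - t) * this.symm

theorem ncard_NC_eq_sum {m n t : ℕ} (hm : 0 < m) :
    (NC m n t).ncard = ∑ b ∈ Finset.range (n + 1), {π ∈ NC m n t | π.parts.card = b}.ncard := by
  have : NC m n t = ⋃ b ∈ (Finset.range (n + 1) : Set ℕ), {π ∈ NC m n t | π.parts.card = b} := by
    ext π
    simp only [Set.mem_iUnion, exists_prop, Finset.mem_coe, Finset.mem_range, Set.mem_ofPred_eq]
    refine ⟨fun h => ⟨_, ?_, h, rfl⟩, fun ⟨_, _, h, _⟩ => h⟩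
    have h1 := h.1.sum_mul_blocksOfSize hm
    rw [h.1.card_parts hm, Nat.lt_succ_iff]
    refine le_of_le_of_eq (Finset.sum_le_sum fun i hi => ?_) h1
    exact Nat.le_mul_of_pos_left _ (Finset.mem_Icc.1 hi).1
  conv_lhs => rw [this]
  rw [Set.Finite.ncard_biUnion (Finset.finite_toSet _)
    (fun _ _ => Set.toFinite _), finsum_mem_coe_finset]
  intro b _ c _ hne
  rw [Function.onFun, Set.disjoint_left]
  rintro π ⟨-, h1⟩ ⟨-, h2⟩
  exact hne (h1.symm.trans h2)

/-- The count for $b$ blocks has a prefactor affine in $b$, so only the two convolutions above are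
needed; `v3` brings them to the same binomial coefficient. -/
theorem ncard_NC {m n t : ℕ} (hm : 0 < m) (hn : 0 < n) (ht : 0 < t) (htmn : t ≤ m * n) :
    ((NC m n t).ncard : ℚ) =
      ((m : ℚ) * t + 1) / ((m : ℚ) * n + 1) * binom ((m + 1) * n - t) ((n : ℤ) - t) := by
  rw [ncard_NC_eq_sum hm]
  push_cast
  rw [Finset.sum_congr rfl fun b _ => ncard_card_parts hm hn ht htmn b]
  rcases lt_or_ge n t with hnt | htn
  · rw [binom_of_lt _ _ _ hnt]
    simp only [Nat.cast_zero, mul_zero]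
    refine Finset.sum_eq_zero fun b hb => ?_
    rw [Finset.mem_range] at hb
    rw [binom_of_lt _ _ _ (by omega)]
    simp
  · have hmn : (m + 1) * n = m * n + n := by ring
    obtain ⟨K, hK⟩ : ∃ K, (m + 1) * n - t = K := ⟨_, rfl⟩
    have hM1 : m * n - t + 1 + n = K + 1 := by omega
    have v1 := sum_binom_mul_choose (m * n - t + 1) htn
    have v2 := sum_mul_binom_mul_choose (m * n - t + 1) ht htn
    rw [hM1] at v1 v2
    rw [Nat.add_sub_cancel] at v2
    have v3 := Nat.choose_mul_succ_eq K (n - t)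
    rw [show K + 1 - (n - t) = m * n + 1 by omega] at v3
    rw [hK, binom_sub _ _ _ htn]
    have hKq : (K : ℚ) + t = m * n + n := by
      exact_mod_cast (by omega : K + t = m * n + n)
    have v1q : ∑ b ∈ Finset.range (n + 1), (binom (m * n - t + 1) ((b : ℤ) - t) * n.choose b : ℚ) =
        (K + 1).choose (n - t) := by exact_mod_cast v1
    have v2q : ∑ b ∈ Finset.range (n + 1),
        (b * (binom (m * n - t + 1) ((b : ℤ) - t) * n.choose b) : ℚ) =
        n * K.choose (n - t) := by exact_mod_cast v2
    have v3q : (K.choose (n - t) : ℚ) * (K + 1) = (K + 1).choose (n - t) * (m * n + 1) := by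
      exact_mod_cast v3
    have hnq : (n : ℚ) ≠ 0 := by positivity
    have hM : (m : ℚ) * n - t + 1 ≠ 0 := by
      have : (t : ℚ) ≤ m * n := by exact_mod_cast htmn
      linarith
    have hmn1 : (m : ℚ) * n + 1 ≠ 0 := by positivity
    have split : ∀ b ∈ Finset.range (n + 1),
        ((m : ℚ) * n * t - b * ((t : ℚ) - 1)) / (n * ((m : ℚ) * n - t + 1)) *
          binom (m * n - t + 1) ((b : ℤ) - t) * n.choose b =
        (m : ℚ) * n * t / (n * ((m : ℚ) * n - t + 1)) *
          (binom (m * n - t + 1) ((b : ℤ) - t) * n.choose b) -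
        ((t : ℚ) - 1) / (n * ((m : ℚ) * n - t + 1)) *
          (b * (binom (m * n - t + 1) ((b : ℤ) - t) * n.choose b)) := by
      intro b _; ring
    rw [Finset.sum_congr rfl split, Finset.sum_sub_distrib, ← Finset.mul_sum, ← Finset.mul_sum,
      v1q, v2q, eq_div_of_mul_eq hmn1 v3q.symm, eq_sub_of_add_eq hKq]
    field_simp
    ring

end TNoncrossing

theorem theorem3p1 (m n t : ℕ) (hm : 0 < m) (hn : 0 < n) (ht : 0 < t) (htmn : t ≤ m * n) :
    -- prescribed block sizes
    (∀ b : ℕ → ℕ,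
      (∑ i ∈ Finset.Icc 1 n, i * b i = n →
        (Set.ncard {π ∈ TNoncrossing.NC m n t |
            ∀ i ∈ Finset.Icc 1 n, TNoncrossing.blocksOfSize π (m * i) = b i} : ℚ) =
          (((m : ℚ) * n - t + 1) * (∑ i ∈ Finset.Icc 1 n, b i : ℕ)
              - (m : ℚ) * n * ((∑ i ∈ Finset.Icc 1 n, b i : ℕ) - (t : ℚ))) /
            (((m : ℚ) * n - t + 1) * (∑ i ∈ Finset.Icc 1 n, b i : ℕ)) *
          TNoncrossing.binom (m * n - t + 1) (((∑ i ∈ Finset.Icc 1 n, b i : ℕ) : ℤ) - t) *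
          Nat.multinomial (Finset.Icc 1 n) b) ∧
      (∑ i ∈ Finset.Icc 1 n, i * b i ≠ n →
        Set.ncard {π ∈ TNoncrossing.NC m n t |
            ∀ i ∈ Finset.Icc 1 n, TNoncrossing.blocksOfSize π (m * i) = b i} = 0)) ∧
    -- prescribed rank
    (∀ s : ℕ,
      (Set.ncard {π ∈ TNoncrossing.NC m n t | TNoncrossing.rk π = (s : ℤ)} : ℚ) =
        ((m : ℚ) * n * t - ((n : ℚ) - s) * ((t : ℚ) - 1)) / ((n : ℚ) * ((m : ℚ) * n - t + 1)) *
        TNoncrossing.binom (m * n - t + 1) ((n : ℤ) - s - t) *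
        Nat.choose n s) ∧
    -- total number
    (Set.ncard (TNoncrossing.NC m n t) : ℚ) =
      ((m : ℚ) * t + 1) / ((m : ℚ) * n + 1) *
      TNoncrossing.binom ((m + 1) * n - t) ((n : ℤ) - t) := by

  refine ⟨fun b => ⟨fun hb => ?_, fun hb => ?_⟩, fun s => ?_, ?_⟩
  · exact TNoncrossing.ncard_NCOfType hm hn htmn hb
  · rw [show {π ∈ TNoncrossing.NC m n t | ∀ i ∈ Finset.Icc 1 n,
        TNoncrossing.blocksOfSize π (m * i) = b i} = ∅ from TNoncrossing.NCOfType_eq_empty hm hb,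
      Set.ncard_empty]
  · rcases le_or_gt s n with hs | hs
    · have hset : {π ∈ TNoncrossing.NC m n t | TNoncrossing.rk π = (s : ℤ)} =
          {π ∈ TNoncrossing.NC m n t | π.parts.card = n - s} := by
        ext π
        simp only [Set.mem_ofPred_eq, TNoncrossing.rk]
        exact and_congr_right fun _ => by omega
      rw [hset, TNoncrossing.ncard_card_parts hm hn ht htmn, Nat.choose_symm hs,
        Nat.cast_sub hs, Nat.cast_sub hs]
    -- The number of blocks is non-negative, so the rank never exceeds $n$.
    · have hset : {π ∈ TNoncrossing.NC m n t | TNoncrossing.rk π = (s : ℤ)} = ∅ := by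
        rw [Set.eq_empty_iff_forall_notMem]
        rintro π ⟨-, h⟩
        rw [TNoncrossing.rk] at h
        omega
      rw [hset, Nat.choose_eq_zero_of_lt hs]
      simp
  · exact TNoncrossing.ncard_NC hm hn ht htmn
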